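/- Let $n\ge 2$, let $M^n$ be a smooth Hausdorff manifold with a smooth Riemannian metric $g$, and let $\Omega\subset M$ be a connected open set with compact closure $\overline\Omega$ and smooth boundary $\Sigma=\partial\Omega$, with $\Omega$ lying locally on one side of $\Sigma$. Let $\nu$ be the outward unit normal to $\Sigma$, $\hat g$ the induced metric on $\Sigma$, $h(X,Y)=-\langle\nu,D_XY\rangle$ (for $X,Y$ tangent to $\Sigma$) the second fundamental form and $H=\operatorname{tr}_{\hat g}h$ the mean curvature; let $\operatorname{Ric}$ and $R$ be the Ricci and scalar curvatures of $g$. A static potential on $(\Omega,\Sigma)$ is a function $u\in C^\infty(\overline\Omega)$, not identically zero, with $$-(\Delta u)\,g+\operatorname{Hess}u-u\operatorname{Ric}=0\ \text{ in }\Omega,\qquad u_\nu\,\hat g=u\,h\ \text{ on }\Sigma,$$ and $(\Omega,\Sigma)$ is called non-generic if it admits a static potential. Suppose that $(\Omega,\Sigma)$ is non-generic, that $R=0$ in $\Omega$ and that $H=0$ on $\Sigma$. Then every static potential on $(\Omega,\Sigma)$ is constant on $\overline\Omega$, $\operatorname{Ric}(\nu,\nu)=0$ on $\Sigma$, and the scalar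 curvature $R_\Sigma$ of $(\Sigma,\hat g)$ vanishes identically. -/

import Mathlib

open Set
open scoped Manifold ContDiff

noncomputable section

/-! ## Riemannian geometry in coordinates

`G x` is the matrix `(g_ij)` of a metric at the point with coordinates `x`. -/

namespace Coord

variable {d : ℕ}

/-- The partial derivative `∂_k f` at `x`. -/
def pd (k : Fin d) (f : EuclideanSpace ℝ (Fin d) → ℝ) (x : EuclideanSpace ℝ (Fin d)) : ℝ :=
  fderiv ℝ f x (EuclideanSpace.single k 1)

/-- The Christoffel symbols
`Γ^k_ij = (1/2) Σ_l g^kl (∂_i g_jl + ∂_j g_il - ∂_l g_ij)`, i.e. `D_{∂_i} ∂_j = Σ_k Γ^k_ij ∂_k`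
for the Levi-Civita connection `D`. -/
def christoffel (G : EuclideanSpace ℝ (Fin d) → Matrix (Fin d) (Fin d) ℝ) (k i j : Fin d)
    (x : EuclideanSpace ℝ (Fin d)) : ℝ :=
  (1 / 2 : ℝ) * ∑ l, (G x)⁻¹ k l *
    (pd i (fun y => G y j l) x + pd j (fun y => G y i l) x - pd l (fun y => G y i j) x)

/-- The Ricci curvature
`Ric_ij = Σ_k (∂_k Γ^k_ij - ∂_j Γ^k_ik) + Σ_{k,l} (Γ^k_kl Γ^l_ij - Γ^k_jl Γ^l_ik)`. -/
def ricci (G : EuclideanSpace ℝ (Fin d) → Matrix (Fin d) (Fin d) ℝ) (i j : Fin d)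
    (x : EuclideanSpace ℝ (Fin d)) : ℝ :=
  (∑ k, (pd k (christoffel G k i j) x - pd j (christoffel G k i k) x)) +
    ∑ k, ∑ l, (christoffel G k k l x * christoffel G l i j x -
      christoffel G k j l x * christoffel G l i k x)

/-- The scalar curvature `Σ_{i,j} g^ij Ric_ij`. -/
def scalar (G : EuclideanSpace ℝ (Fin d) → Matrix (Fin d) (Fin d) ℝ)
    (x : EuclideanSpace ℝ (Fin d)) : ℝ :=
  ∑ i, ∑ j, (G x)⁻¹ i j * ricci G i j x

/-- The Hessian `(Hess f)_ij = ∂_i ∂_j f - Σ_k Γ^k_ij ∂_k f`. -/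
def hess (G : EuclideanSpace ℝ (Fin d) → Matrix (Fin d) (Fin d) ℝ)
    (f : EuclideanSpace ℝ (Fin d) → ℝ) (i j : Fin d) (x : EuclideanSpace ℝ (Fin d)) : ℝ :=
  pd i (pd j f) x - ∑ k, christoffel G k i j x * pd k f x

/-- The Laplacian `Δ f = Σ_{i,j} g^ij (Hess f)_ij`. -/
def laplacian (G : EuclideanSpace ℝ (Fin d) → Matrix (Fin d) (Fin d) ℝ)
    (f : EuclideanSpace ℝ (Fin d) → ℝ) (x : EuclideanSpace ℝ (Fin d)) : ℝ :=
  ∑ i, ∑ j, (G x)⁻¹ i j * hess G f i j x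

end Coord

/-! ## Domains with smooth boundary in a Riemannian manifold

`M` is a smooth manifold of dimension `m + 1`. All tensors are given by their components in a smooth
chart `e`; an equation between tensors is required in every smooth chart. -/

namespace StaticBoundary

variable {m : ℕ} {M : Type*} [TopologicalSpace M]
  [ChartedSpace (EuclideanSpace ℝ (Fin (m + 1))) M]

/-- Smooth Riemannian metrics on `M`. -/
abbrev SmoothMetric (m : ℕ) (M : Type*) [TopologicalSpace M]
    [ChartedSpace (EuclideanSpace ℝ (Fin (m + 1))) M]
    [IsManifold 𝓘(ℝ, EuclideanSpace ℝ (Fin (m + 1))) ∞ M] :=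
  Bundle.ContMDiffRiemannianMetric 𝓘(ℝ, EuclideanSpace ℝ (Fin (m + 1))) ∞
    (EuclideanSpace ℝ (Fin (m + 1)))
    (TangentSpace 𝓘(ℝ, EuclideanSpace ℝ (Fin (m + 1))) : M → Type _)

/-- `e` is a chart of the smooth structure of `M`. -/
def IsSmoothChart (e : OpenPartialHomeomorph M (EuclideanSpace ℝ (Fin (m + 1)))) : Prop :=
  e ∈ IsManifold.maximalAtlas 𝓘(ℝ, EuclideanSpace ℝ (Fin (m + 1))) ∞ M

/-- A boundary chart of `Ω`: a smooth chart that maps `Ω` to the half-space `{x | 0 < x 0}`, and hence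
the boundary of `Ω` to the hyperplane `{x | x 0 = 0}`. -/
def IsBoundaryChart (Ω : Set M)
    (e : OpenPartialHomeomorph M (EuclideanSpace ℝ (Fin (m + 1)))) : Prop :=
  IsSmoothChart e ∧ ∀ q ∈ e.source, (q ∈ Ω ↔ 0 < e q 0)

/-- `Ω` is a smooth domain: open, connected, and near each point of `frontier Ω` it is one side of a
smooth hypersurface. Then `closure Ω` is a manifold with boundary `frontier Ω`. -/
structure IsSmoothDomain (m : ℕ) {M : Type*} [TopologicalSpace M]
    [ChartedSpace (EuclideanSpace ℝ (Fin (m + 1))) M] (Ω : Set M) : Prop where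
  isOpen : IsOpen Ω
  isConnected : IsConnected Ω
  exists_boundaryChart : ∀ p ∈ frontier Ω,
    ∃ e : OpenPartialHomeomorph M (EuclideanSpace ℝ (Fin (m + 1))),
      IsBoundaryChart Ω e ∧ p ∈ e.source

variable [IsManifold 𝓘(ℝ, EuclideanSpace ℝ (Fin (m + 1))) ∞ M]

/-- The matrix `g_ij = g(∂_i, ∂_j)` of the metric in the chart `e`, at the point with coordinates
`x`. -/
def metricCoeff (g : SmoothMetric m M)
    (e : OpenPartialHomeomorph M (EuclideanSpace ℝ (Fin (m + 1))))
    (x : EuclideanSpace ℝ (Fin (m + 1))) : Matrix (Fin (m + 1)) (Fin (m + 1)) ℝ :=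
  Matrix.of fun i j => g.inner (e.symm x)
    (mfderiv 𝓘(ℝ, EuclideanSpace ℝ (Fin (m + 1))) 𝓘(ℝ, EuclideanSpace ℝ (Fin (m + 1))) e.symm x
      (EuclideanSpace.single i (1 : ℝ)))
    (mfderiv 𝓘(ℝ, EuclideanSpace ℝ (Fin (m + 1))) 𝓘(ℝ, EuclideanSpace ℝ (Fin (m + 1))) e.symm x
      (EuclideanSpace.single j (1 : ℝ)))

/-- The components of the Ricci tensor of `g` at `p`, in the chart `e`. -/
def ricciCurvature (g : SmoothMetric m M)
    (e : OpenPartialHomeomorph M (EuclideanSpace ℝ (Fin (m + 1)))) (p : M)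
    (i j : Fin (m + 1)) : ℝ :=
  Coord.ricci (metricCoeff g e) i j (e p)

/-- The scalar curvature of `g` at `p`, computed in the chart `e`. -/
def scalarCurvature (g : SmoothMetric m M)
    (e : OpenPartialHomeomorph M (EuclideanSpace ℝ (Fin (m + 1)))) (p : M) : ℝ :=
  Coord.scalar (metricCoeff g e) (e p)

/-- The components at `p` of `L^* u = -(Δ u) g + Hess u - u Ric`, in the chart `e`. -/
def staticOp (g : SmoothMetric m M)
    (e : OpenPartialHomeomorph M (EuclideanSpace ℝ (Fin (m + 1)))) (u : M → ℝ) (p : M)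
    (i j : Fin (m + 1)) : ℝ :=
  -(Coord.laplacian (metricCoeff g e) (u ∘ e.symm) (e p)) * metricCoeff g e (e p) i j
    + Coord.hess (metricCoeff g e) (u ∘ e.symm) i j (e p)
    - u p * ricciCurvature g e p i j

/-! ### The boundary

In a boundary chart `e` the boundary is `{x 0 = 0}`; it has the coordinates `x 1, …, x m` and the
coordinate fields `∂_(i+1)` for `i : Fin m`. -/

/-- The matrix of the metric induced on the boundary, in the coordinates that the boundary chart `e`
gives on it. -/
def inducedCoeff (g : SmoothMetric m M)
    (e : OpenPartialHomeomorph M (EuclideanSpace ℝ (Fin (m + 1))))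
    (y : EuclideanSpace ℝ (Fin m)) : Matrix (Fin m) (Fin m) ℝ :=
  Matrix.of fun i j =>
    metricCoeff g e (WithLp.toLp 2 (Fin.cons 0 y.ofLp : Fin (m + 1) → ℝ)) i.succ j.succ

/-- The coordinates on the boundary of a point `p` of the boundary. -/
def boundaryCoord (e : OpenPartialHomeomorph M (EuclideanSpace ℝ (Fin (m + 1)))) (p : M) :
    EuclideanSpace ℝ (Fin m) :=
  WithLp.toLp 2 fun i => e p i.succ

/-- The (intrinsic) scalar curvature of the boundary with the induced metric. -/
def boundaryScalarCurvature (g : SmoothMetric m M)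
    (e : OpenPartialHomeomorph M (EuclideanSpace ℝ (Fin (m + 1)))) (p : M) : ℝ :=
  Coord.scalar (inducedCoeff g e) (boundaryCoord e p)

/-- The components of the outward unit normal `ν = -(grad x_0) / |grad x_0|` at the boundary point
`p`: `ν^k = -g^k0 / √(g^00)`. -/
def normal (g : SmoothMetric m M)
    (e : OpenPartialHomeomorph M (EuclideanSpace ℝ (Fin (m + 1)))) (p : M)
    (k : Fin (m + 1)) : ℝ :=
  -((metricCoeff g e (e p))⁻¹ k 0) / √((metricCoeff g e (e p))⁻¹ 0 0)

/-- The second fundamental form `h(X, Y) = -⟨ν, D_X Y⟩` of the boundary at `p`, for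
`X = ∂_(i+1)` and `Y = ∂_(j+1)`. -/
def secondFF (g : SmoothMetric m M)
    (e : OpenPartialHomeomorph M (EuclideanSpace ℝ (Fin (m + 1)))) (p : M)
    (i j : Fin m) : ℝ :=
  -∑ k, ∑ l, metricCoeff g e (e p) k l * normal g e p k *
    Coord.christoffel (metricCoeff g e) l i.succ j.succ (e p)

/-- The mean curvature `H` at `p`: the trace of `h` with respect to the induced metric. -/
def meanCurvature (g : SmoothMetric m M)
    (e : OpenPartialHomeomorph M (EuclideanSpace ℝ (Fin (m + 1)))) (p : M) : ℝ :=
  ∑ i, ∑ j, (inducedCoeff g e (boundaryCoord e p))⁻¹ i j * secondFF g e p i j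

/-- The normal curvature `Ric(ν, ν)` at the boundary point `p`. -/
def ricciNormal (g : SmoothMetric m M)
    (e : OpenPartialHomeomorph M (EuclideanSpace ℝ (Fin (m + 1)))) (p : M) : ℝ :=
  ∑ i, ∑ j, normal g e p i * normal g e p j * ricciCurvature g e p i j

/-- The outward normal derivative `u_ν` at the boundary point `p` of a function on the closure of the
domain (one-sided: `closure Ω` is `{x | 0 ≤ x 0}` in a boundary chart). -/
def normalDeriv (g : SmoothMetric m M)
    (e : OpenPartialHomeomorph M (EuclideanSpace ℝ (Fin (m + 1)))) (u : M → ℝ) (p : M) : ℝ :=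
  fderivWithin ℝ (u ∘ e.symm) {x : EuclideanSpace ℝ (Fin (m + 1)) | 0 ≤ x 0} (e p)
    (WithLp.toLp 2 (normal g e p))

/-- `u` is a static potential on `(Ω, ∂Ω)`: a non-trivial function, smooth on the closure of `Ω` (its
values elsewhere play no role), with `-(Δ u) g + Hess u - u Ric = 0` in `Ω` and `u_ν ĝ = u h` on the
boundary. -/
structure IsStaticPotential (g : SmoothMetric m M) (Ω : Set M) (u : M → ℝ) : Prop where
  smooth : ContMDiffOn 𝓘(ℝ, EuclideanSpace ℝ (Fin (m + 1))) 𝓘(ℝ, ℝ) ∞ u (closure Ω)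
  nontrivial : ∃ p ∈ closure Ω, u p ≠ 0
  interior_eq : ∀ e : OpenPartialHomeomorph M (EuclideanSpace ℝ (Fin (m + 1))),
    IsSmoothChart e → ∀ p ∈ e.source ∩ Ω, ∀ i j, staticOp g e u p i j = 0
  boundary_eq : ∀ e : OpenPartialHomeomorph M (EuclideanSpace ℝ (Fin (m + 1))),
    IsBoundaryChart Ω e → ∀ p ∈ e.source ∩ frontier Ω, ∀ i j : Fin m,
      normalDeriv g e u p * inducedCoeff g e (boundaryCoord e p) i j = u p * secondFF g e p i j

/-- `(Ω, ∂Ω)` is a compact non-generic domain in `(M, g)`. -/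
structure IsCompactNonGenericDomain (g : SmoothMetric m M) (Ω : Set M) : Prop where
  smoothDomain : IsSmoothDomain m Ω
  isCompact : IsCompact (closure Ω)
  exists_potential : ∃ u : M → ℝ, IsStaticPotential g Ω u

end StaticBoundary

end

/-!
The proof uses the maximum principle. Tracing the static equation with `R = 0` gives
`(1 - n) Δu = 0`, and tracing the boundary condition with `H = 0` gives `(n - 1) u_ν = 0`; so `u` is
harmonic with vanishing Neumann data. Since `closure Ω` is compact, `u` attains its maximum. If it did
so only on the boundary, the Hopf lemma `Coord.hasFDerivWithinAt_neg_of_harmonic` would give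
`u_ν ≠ 0`; so it does inside, and the strong maximum principle
`Coord.eventually_eq_of_harmonic_of_isLocalMax` with the connectedness of `Ω` makes `u` constant
(`StaticBoundary.IsStaticPotential.exists_eq_const`). Both principles are local, so everything takes
place in charts and no integration over `M` is needed. The Hopf lemma is proved for a region `{0 < φ}`
with the barrier `φ + A φ² - |x - z|²`, which serves for half-spaces (boundary charts) as well as for
balls (the interior).

A nonzero constant potential turns the static equation into `Ric = 0` and the boundary condition into
`h = 0`. The Gauss equation, in the case needed here (`Coord.scalar_induced_eq_zero`), then gives
`R_Σ = 0`. For it, the Christoffel symbols of the induced metric are the tangential ones of `g`, so that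
the Ricci tensor of the boundary is `Ric_ij - R^0_i0j = -R^0_i0j`; its trace reduces to a contraction of
`Ric` by the skew symmetry of the curvature tensor in its first two indices.
-/

noncomputable section
open Filter Topology Matrix

namespace Coord

variable {d : ℕ}

/-! ### Calculus of partial derivatives -/

section PartialDerivatives

variable {f f₁ f₂ : EuclideanSpace ℝ (Fin d) → ℝ} {x : EuclideanSpace ℝ (Fin d)}

lemma fderiv_apply_eq_sum_pd (f : EuclideanSpace ℝ (Fin d) → ℝ) (x b : EuclideanSpace ℝ (Fin d)) :
    fderiv ℝ f x b = ∑ i, b i * pd i f x := by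
  have hb : b = ∑ i, b i • EuclideanSpace.single i (1 : ℝ) := by
    ext j
    simp [Pi.single_apply]
  conv_lhs => rw [hb]
  simp [map_sum, pd]

lemma pd_congr (k : Fin d) (h : f₁ =ᶠ[𝓝 x] f₂) : pd k f₁ x = pd k f₂ x := by
  simp only [pd, h.fderiv_eq]

lemma pd_congr_eventually (k : Fin d) (h : f₁ =ᶠ[𝓝 x] f₂) : pd k f₁ =ᶠ[𝓝 x] pd k f₂ := by
  filter_upwards [h.eventually_nhds] with y hy using pd_congr k hy

lemma pd_const (k : Fin d) (c : ℝ) : pd k (fun _ => c) x = 0 := by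
  simp [pd]

lemma pd_add (k : Fin d) (h₁ : DifferentiableAt ℝ f₁ x) (h₂ : DifferentiableAt ℝ f₂ x) :
    pd k (fun y => f₁ y + f₂ y) x = pd k f₁ x + pd k f₂ x := by
  simp only [pd]
  rw [fderiv_fun_add h₁ h₂]
  rfl

lemma pd_const_mul (k : Fin d) (c : ℝ) (f : EuclideanSpace ℝ (Fin d) → ℝ)
    (h : DifferentiableAt ℝ f x) : pd k (fun y => c * f y) x = c * pd k f x := by
  simp only [pd]
  rw [fderiv_const_mul h]
  rfl

lemma pd_mul (k : Fin d) (h₁ : DifferentiableAt ℝ f₁ x) (h₂ : DifferentiableAt ℝ f₂ x) :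
    pd k (fun y => f₁ y * f₂ y) x = f₁ x * pd k f₂ x + pd k f₁ x * f₂ x := by
  simp only [pd]
  rw [fderiv_fun_mul h₁ h₂]
  simp [mul_comm]

lemma pd_sum {ι : Type*} (s : Finset ι) (k : Fin d) {F : ι → EuclideanSpace ℝ (Fin d) → ℝ}
    (h : ∀ i ∈ s, DifferentiableAt ℝ (F i) x) :
    pd k (fun y => ∑ i ∈ s, F i y) x = ∑ i ∈ s, pd k (F i) x := by
  simp only [pd]
  rw [fderiv_fun_sum h]
  simp

lemma contDiffAt_pd {n k : WithTop ℕ∞} (i : Fin d) (hf : ContDiffAt ℝ n f x) (hk : k + 1 ≤ n) :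
    ContDiffAt ℝ k (pd i f) x :=
  (hf.fderiv_right hk).clm_apply contDiffAt_const

lemma contDiffAt_pd_infty (i : Fin d) (hf : ContDiffAt ℝ ∞ f x) : ContDiffAt ℝ ∞ (pd i f) x :=
  contDiffAt_pd i hf (by simp)

/-- Symmetry of second partial derivatives. -/
lemma pd_comm (i j : Fin d) (hf : ContDiffAt ℝ 2 f x) : pd i (pd j f) x = pd j (pd i f) x := by
  have hd : DifferentiableAt ℝ (fderiv ℝ f) x :=
    (hf.fderiv_right (m := 1) (by norm_num)).differentiableAt one_ne_zero
  have key : ∀ a b : Fin d, pd a (pd b f) x =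
      fderiv ℝ (fderiv ℝ f) x (EuclideanSpace.single a 1) (EuclideanSpace.single b 1) := by
    intro a b
    have : pd b f = fun y => fderiv ℝ f y (EuclideanSpace.single b 1) := rfl
    rw [pd, this, fderiv_clm_apply hd (differentiableAt_const _)]
    simp
  rw [key, key]
  exact (hf.isSymmSndFDerivAt (by simp)).eq _ _

end PartialDerivatives

/-! ### Smoothness of the curvature quantities -/

section Smoothness

variable {G : EuclideanSpace ℝ (Fin d) → Matrix (Fin d) (Fin d) ℝ} {x : EuclideanSpace ℝ (Fin d)}
  {f f₁ f₂ : EuclideanSpace ℝ (Fin d) → ℝ}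

lemma contDiffAt_det {ι : Type*} [Fintype ι] [DecidableEq ι]
    {A : EuclideanSpace ℝ (Fin d) → Matrix ι ι ℝ}
    (hA : ∀ i j, ContDiffAt ℝ ∞ (fun y => A y i j) x) :
    ContDiffAt ℝ ∞ (fun y => (A y).det) x := by
  simp only [Matrix.det_apply, zsmul_eq_mul, Units.smul_def]
  exact ContDiffAt.sum fun σ _ => contDiffAt_const.mul (contDiffAt_prod fun i _ => hA _ _)

lemma contDiffAt_inv (hG : ∀ i j, ContDiffAt ℝ ∞ (fun y => G y i j) x) (hdet : (G x).det ≠ 0)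
    (i j : Fin d) : ContDiffAt ℝ ∞ (fun y => (G y)⁻¹ i j) x := by
  simp only [Matrix.inv_def, Matrix.smul_apply, Ring.inverse_eq_inv', smul_eq_mul,
    Matrix.adjugate_apply]
  refine ((contDiffAt_det hG).inv hdet).mul (contDiffAt_det fun a b => ?_)
  by_cases h : a = j
  · subst h
    simp only [Matrix.updateRow_self]
    exact contDiffAt_const
  · simp only [Matrix.updateRow_ne h]
    exact hG a b

lemma contDiffAt_christoffel (hG : ∀ i j, ContDiffAt ℝ ∞ (fun y => G y i j) x)
    (hdet : (G x).det ≠ 0) (k i j : Fin d) : ContDiffAt ℝ ∞ (christoffel G k i j) x := by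
  unfold christoffel
  refine contDiffAt_const.mul (ContDiffAt.sum fun l _ => (contDiffAt_inv hG hdet k l).mul ?_)
  exact ((contDiffAt_pd_infty _ (hG _ _)).add (contDiffAt_pd_infty _ (hG _ _))).sub
    (contDiffAt_pd_infty _ (hG _ _))

lemma contDiffAt_ricci (hG : ∀ i j, ContDiffAt ℝ ∞ (fun y => G y i j) x)
    (hdet : (G x).det ≠ 0) (i j : Fin d) : ContDiffAt ℝ ∞ (ricci G i j) x := by
  have hΓ := contDiffAt_christoffel hG hdet
  unfold ricci
  refine (ContDiffAt.sum fun k _ => ?_).add (ContDiffAt.sum fun k _ => ContDiffAt.sum fun l _ => ?_)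
  · exact (contDiffAt_pd_infty _ (hΓ _ _ _)).sub (contDiffAt_pd_infty _ (hΓ _ _ _))
  · exact ((hΓ _ _ _).mul (hΓ _ _ _)).sub ((hΓ _ _ _).mul (hΓ _ _ _))

lemma contDiffAt_laplacian (hG : ∀ i j, ContDiffAt ℝ ∞ (fun y => G y i j) x)
    (hdet : (G x).det ≠ 0) (hf : ContDiffAt ℝ ∞ f x) : ContDiffAt ℝ ∞ (laplacian G f) x := by
  have hΓ := contDiffAt_christoffel hG hdet
  unfold laplacian hess
  refine ContDiffAt.sum fun i _ => ContDiffAt.sum fun j _ => (contDiffAt_inv hG hdet i j).mul ?_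
  refine (contDiffAt_pd_infty _ (contDiffAt_pd_infty _ hf)).sub (ContDiffAt.sum fun k _ => ?_)
  exact (hΓ _ _ _).mul (contDiffAt_pd_infty _ hf)

end Smoothness

/-! ### The Laplacian and maxima -/

section Laplacian

variable {G : EuclideanSpace ℝ (Fin d) → Matrix (Fin d) (Fin d) ℝ} {x : EuclideanSpace ℝ (Fin d)}
  {f f₁ f₂ : EuclideanSpace ℝ (Fin d) → ℝ}

lemma eventually_differentiableAt (hf : ContDiffAt ℝ 2 f x) :
    ∀ᶠ y in 𝓝 x, DifferentiableAt ℝ f y := by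
  filter_upwards [hf.eventually (by simp)] with y hy using hy.differentiableAt two_ne_zero

lemma differentiableAt_pd (i : Fin d) (hf : ContDiffAt ℝ 2 f x) :
    DifferentiableAt ℝ (pd i f) x :=
  (contDiffAt_pd (k := 1) i hf (by norm_num)).differentiableAt one_ne_zero

lemma hess_add (h₁ : ContDiffAt ℝ 2 f₁ x) (h₂ : ContDiffAt ℝ 2 f₂ x) (i j : Fin d) :
    hess G (fun y => f₁ y + f₂ y) i j x = hess G f₁ i j x + hess G f₂ i j x := by
  have hev : pd j (fun y => f₁ y + f₂ y) =ᶠ[𝓝 x] fun y => pd j f₁ y + pd j f₂ y := by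
    filter_upwards [eventually_differentiableAt h₁, eventually_differentiableAt h₂] with y h h'
      using pd_add j h h'
  have hk : ∀ k, pd k (fun y => f₁ y + f₂ y) x = pd k f₁ x + pd k f₂ x := fun k =>
    pd_add k (h₁.differentiableAt two_ne_zero) (h₂.differentiableAt two_ne_zero)
  simp only [hess, hk, pd_congr i hev, pd_add i (differentiableAt_pd j h₁)
    (differentiableAt_pd j h₂), mul_add, Finset.sum_add_distrib]
  ring

lemma hess_const_mul (c : ℝ) (h : ContDiffAt ℝ 2 f x) (i j : Fin d) :
    hess G (fun y => c * f y) i j x = c * hess G f i j x := by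
  have hev : pd j (fun y => c * f y) =ᶠ[𝓝 x] fun y => c * pd j f y := by
    filter_upwards [eventually_differentiableAt h] with y h using pd_const_mul j c f h
  have hk : ∀ k, pd k (fun y => c * f y) x = c * pd k f x := fun k =>
    pd_const_mul k c f (h.differentiableAt two_ne_zero)
  simp only [hess, hk, pd_congr i hev, pd_const_mul i c _ (differentiableAt_pd j h), mul_sub,
    Finset.mul_sum]
  congr 1
  exact Finset.sum_congr rfl fun k _ => by ring

lemma hess_sq (h : ContDiffAt ℝ 2 f x) (i j : Fin d) :
    hess G (fun y => f y * f y) i j x =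
      2 * f x * hess G f i j x + 2 * (pd i f x * pd j f x) := by
  have hd := h.differentiableAt two_ne_zero
  have hev : pd j (fun y => f y * f y) =ᶠ[𝓝 x] fun y => 2 * (f y * pd j f y) := by
    filter_upwards [eventually_differentiableAt h] with y h
    rw [pd_mul j h h]
    ring
  have hk : ∀ k, pd k (fun y => f y * f y) x = 2 * f x * pd k f x := fun k => by
    rw [pd_mul k hd hd]
    ring
  simp only [hess, hk, pd_congr i hev]
  rw [pd_const_mul i 2 (fun y => f y * pd j f y) (hd.mul (differentiableAt_pd j h)), pd_mul i hd (differentiableAt_pd j h),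
    mul_sub, Finset.mul_sum]
  have : ∀ k, christoffel G k i j x * (2 * f x * pd k f x) =
      2 * f x * (christoffel G k i j x * pd k f x) := fun k => by ring
  simp only [this]
  ring

lemma laplacian_add (h₁ : ContDiffAt ℝ 2 f₁ x) (h₂ : ContDiffAt ℝ 2 f₂ x) :
    laplacian G (fun y => f₁ y + f₂ y) x = laplacian G f₁ x + laplacian G f₂ x := by
  simp only [laplacian, hess_add h₁ h₂, mul_add, Finset.sum_add_distrib]

lemma laplacian_const_mul (c : ℝ) (h : ContDiffAt ℝ 2 f x) :
    laplacian G (fun y => c * f y) x = c * laplacian G f x := by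
  simp only [laplacian, hess_const_mul c h, Finset.mul_sum]
  exact Finset.sum_congr rfl fun i _ => Finset.sum_congr rfl fun j _ => by ring

/-- At a zero of `f`, the Laplacian of `f²` is `2 |∇f|²`. -/
lemma laplacian_sq_of_eq_zero (h : ContDiffAt ℝ 2 f x) (h0 : f x = 0) :
    laplacian G (fun y => f y * f y) x =
      2 * ∑ i, ∑ j, (G x)⁻¹ i j * (pd i f x * pd j f x) := by
  simp only [laplacian, hess_sq h, h0, Finset.mul_sum]
  exact Finset.sum_congr rfl fun i _ => Finset.sum_congr rfl fun j _ => by ring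

lemma hess_eq_zero_of_eventually_const {c : ℝ} (h : ∀ᶠ y in 𝓝 x, f y = c) (i j : Fin d) :
    hess G f i j x = 0 := by
  have h' : f =ᶠ[𝓝 x] fun _ => c := h
  have h1 : ∀ k, pd k f =ᶠ[𝓝 x] fun _ => 0 := fun k =>
    (pd_congr_eventually k h').trans (Eventually.of_forall fun y => pd_const k c)
  simp [hess, pd_congr i (h1 j), pd_const, (h1 _).eq_of_nhds]

/-- At a local maximum the second derivative in any direction is nonpositive. -/
lemma sum_pd_pd_nonpos_of_isLocalMax (hf : ContDiffAt ℝ 2 f x) (hmax : IsLocalMax f x)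
    (b : EuclideanSpace ℝ (Fin d)) : ∑ i, ∑ j, b i * b j * pd i (pd j f) x ≤ 0 := by
  set γ : ℝ → EuclideanSpace ℝ (Fin d) := fun t => x + t • b with hγ
  have hγ0 : γ 0 = x := by simp [hγ]
  have hγd : ∀ t, HasDerivAt γ b t := fun t => by
    simpa [hγ] using ((hasDerivAt_id t).smul_const b).const_add x
  have hγt : Tendsto γ (𝓝 0) (𝓝 x) := by
    have := (hγd 0).continuousAt.tendsto
    rwa [hγ0] at this
  have hchain : ∀ (F : EuclideanSpace ℝ (Fin d) → ℝ) t, DifferentiableAt ℝ F (γ t) →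
      deriv (F ∘ γ) t = ∑ i, b i * pd i F (γ t) := fun F t hF => by
    rw [← fderiv_apply_eq_sum_pd]
    exact (hF.hasFDerivAt.comp_hasDerivAt t (hγd t)).deriv
  have h1 : deriv (f ∘ γ) =ᶠ[𝓝 0] (fun y => ∑ j, b j * pd j f y) ∘ γ := by
    filter_upwards [hγt.eventually (eventually_differentiableAt hf)] with t ht
    exact hchain f t ht
  have hsd : ∀ j ∈ Finset.univ, DifferentiableAt ℝ (fun y => b j * pd j f y) x := fun j _ =>
    (differentiableAt_pd j hf).const_mul _
  have h2 : deriv (deriv (f ∘ γ)) 0 = ∑ i, ∑ j, b i * b j * pd i (pd j f) x := by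
    rw [h1.deriv_eq, hchain _ 0 (by rw [hγ0]; exact DifferentiableAt.fun_sum hsd), hγ0]
    refine Finset.sum_congr rfl fun i _ => ?_
    rw [pd_sum _ _ hsd, Finset.mul_sum]
    refine Finset.sum_congr rfl fun j _ => ?_
    rw [pd_const_mul _ _ _ (differentiableAt_pd j hf)]
    ring
  rw [← h2]
  by_contra! hpos
  have hmax' : IsLocalMax (f ∘ γ) 0 := by
    filter_upwards [hγt.eventually hmax] with t ht
    simpa [hγ0] using ht
  have hcont : ContinuousAt (f ∘ γ) 0 := by
    have : ContinuousAt f (γ 0) := by rw [hγ0]; exact hf.continuousAt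
    exact this.comp (hγd 0).continuousAt
  -- The second-derivative test makes `0` a local minimum too, so `f ∘ γ` is constant near `0`.
  have hmin := isLocalMin_of_deriv_deriv_pos hpos hmax'.deriv_eq_zero hcont
  have hconst : f ∘ γ =ᶠ[𝓝 0] fun _ => (f ∘ γ) 0 := by
    filter_upwards [hmin, hmax'] with t h h' using le_antisymm h' h
  have : deriv (deriv (f ∘ γ)) 0 = 0 := by
    have h3 := hconst.deriv
    rw [h3.deriv_eq]
    simp
  exact hpos.ne' this

lemma laplacian_nonpos_of_isLocalMax (hG : (G x)⁻¹.PosSemidef) (hf : ContDiffAt ℝ 2 f x)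
    (hmax : IsLocalMax f x) : laplacian G f x ≤ 0 := by
  have hpd : ∀ k, pd k f x = 0 := fun k => by simp [pd, hmax.fderiv_eq_zero]
  open scoped MatrixOrder in
  obtain ⟨B, hB⟩ := CStarAlgebra.nonneg_iff_eq_star_mul_self.mp hG.nonneg
  have hterm : ∀ k, ∑ i, ∑ j, B k i * B k j * pd i (pd j f) x ≤ 0 := fun k =>
    sum_pd_pd_nonpos_of_isLocalMax hf hmax (WithLp.toLp 2 (B k))
  have hsum : laplacian G f x = ∑ k, ∑ i, ∑ j, B k i * B k j * pd i (pd j f) x := by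
    simp only [laplacian, hess, hpd, mul_zero, Finset.sum_const_zero, sub_zero, hB,
      Matrix.star_eq_conjTranspose, Matrix.mul_apply, Matrix.conjTranspose_apply, star_trivial,
      Finset.sum_mul]
    symm
    rw [Finset.sum_comm]
    refine Finset.sum_congr rfl fun i _ => ?_
    rw [Finset.sum_comm]
  rw [hsum]
  exact Finset.sum_nonpos fun k _ => hterm k

end Laplacian

/-! ### The Hopf boundary point lemma -/

section Hopf

variable {G : EuclideanSpace ℝ (Fin d) → Matrix (Fin d) (Fin d) ℝ} {z : EuclideanSpace ℝ (Fin d)}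
  {φ : EuclideanSpace ℝ (Fin d) → ℝ}

/-- The barrier `φ + A φ² - |x - z|²`. -/
def barrier (φ : EuclideanSpace ℝ (Fin d) → ℝ) (A : ℝ) (z x : EuclideanSpace ℝ (Fin d)) : ℝ :=
  φ x + (A * (φ x * φ x) + (-1) * ‖x - z‖ ^ 2)

lemma contDiff_barrier (hφ : ContDiff ℝ ∞ φ) (A : ℝ) : ContDiff ℝ ∞ (barrier φ A z) := by
  unfold barrier
  exact hφ.add ((contDiff_const.mul (hφ.mul hφ)).add
    (contDiff_const.mul ((contDiff_id.sub contDiff_const).norm_sq ℝ)))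

lemma fderiv_barrier (hφ : ContDiff ℝ ∞ φ) (hφz : φ z = 0) (A : ℝ) :
    fderiv ℝ (barrier φ A z) z = fderiv ℝ φ z := by
  have h1 : HasFDerivAt φ (fderiv ℝ φ z) z := (hφ.differentiable (by simp) z).hasFDerivAt
  have h2 : HasFDerivAt (fun x => ‖x - z‖ ^ 2) (0 : EuclideanSpace ℝ (Fin d) →L[ℝ] ℝ) z := by
    simpa using ((hasFDerivAt_id z).sub_const z).norm_sq
  have := h1.add (((h1.mul h1).const_mul A).add (h2.const_mul (-1)))
  have h3 : fderiv ℝ (barrier φ A z) z = _ := this.fderiv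
  rw [h3]
  simp [hφz]

/-- For large `A` the barrier is strictly subharmonic near `z`: at `z` the Laplacian of `A φ²` is
`2 A |∇φ|²`. -/
lemma exists_barrier_laplacian_pos (hG : ∀ i j, ContDiffAt ℝ ∞ (fun y => G y i j) z)
    (hpos : (G z).PosDef) (hφ : ContDiff ℝ ∞ φ) (hφz : φ z = 0) (hdφ : fderiv ℝ φ z ≠ 0) :
    ∃ A : ℝ, ∀ᶠ x in 𝓝 z, 0 < laplacian G (barrier φ A z) x := by
  have h2 : ∀ f : EuclideanSpace ℝ (Fin d) → ℝ, ContDiff ℝ ∞ f → ContDiffAt ℝ 2 f z :=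
    fun f hf => hf.contDiffAt.of_le (by norm_cast)
  set q : EuclideanSpace ℝ (Fin d) → ℝ := fun x => ‖x - z‖ ^ 2 with hq
  have hqs : ContDiff ℝ ∞ q := (contDiff_id.sub contDiff_const).norm_sq ℝ
  set N := ∑ i, ∑ j, (G z)⁻¹ i j * (pd i φ z * pd j φ z) with hN
  have hNpos : 0 < N := by
    have hne : (fun i => pd i φ z) ≠ 0 := fun h => hdφ <| by
      ext b
      rw [fderiv_apply_eq_sum_pd]
      simp [fun i => congrFun h i]
    have := hpos.inv.dotProduct_mulVec_pos hne
    simp only [dotProduct, Matrix.mulVec, Pi.star_apply, star_trivial, Finset.mul_sum] at this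
    rw [hN]
    refine this.trans_eq (Finset.sum_congr rfl fun i _ => Finset.sum_congr rfl fun j _ => ?_)
    ring
  have hlap : ∀ A, laplacian G (barrier φ A z) z =
      laplacian G φ z + (A * (2 * N) + (-1) * laplacian G q z) := fun A => by
    unfold barrier
    rw [laplacian_add (h2 _ hφ) (h2 _ ((contDiff_const.mul (hφ.mul hφ)).add
        (contDiff_const.mul hqs))),
      laplacian_add (h2 _ (contDiff_const.mul (hφ.mul hφ))) (h2 _ (contDiff_const.mul hqs)),
      laplacian_const_mul A (h2 _ (hφ.mul hφ)), laplacian_const_mul (-1) (h2 _ hqs),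
      laplacian_sq_of_eq_zero (h2 _ hφ) hφz]
  refine ⟨(laplacian G q z - laplacian G φ z + 1) / (2 * N), ?_⟩
  have hc := (contDiffAt_laplacian hG hpos.det_pos.ne' (contDiff_barrier (z := z) hφ
    ((laplacian G q z - laplacian G φ z + 1) / (2 * N))).contDiffAt).continuousAt
  refine hc.eventually (lt_mem_nhds ?_)
  rw [hlap, div_mul_cancel₀ _ (by positivity)]
  linarith

/-- The Hopf boundary point lemma. If `v` is harmonic on `{0 < φ}` near the boundary point `z` and has
there a maximum over `{0 ≤ φ}` that is strict inside, then its derivative in every inward direction is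
negative. -/
theorem hasFDerivWithinAt_neg_of_harmonic (hG : ∀ i j, ContDiffAt ℝ ∞ (fun y => G y i j) z)
    (hpos : ∀ᶠ x in 𝓝 z, (G x).PosDef) (hφ : ContDiff ℝ ∞ φ) (hφz : φ z = 0)
    {v : EuclideanSpace ℝ (Fin d) → ℝ} {U : Set (EuclideanSpace ℝ (Fin d))} (hU : U ∈ 𝓝 z)
    (hv2 : ∀ x ∈ U, 0 < φ x → ContDiffAt ℝ 2 v x)
    (hvc : ContinuousOn v (U ∩ {x | 0 ≤ φ x}))
    (hlap : ∀ x ∈ U, 0 < φ x → laplacian G v x = 0)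
    (hlt : ∀ x ∈ U, 0 < φ x → v x < v z) (hle : ∀ x ∈ U, φ x = 0 → v x ≤ v z)
    {v' : EuclideanSpace ℝ (Fin d) →L[ℝ] ℝ} (hv' : HasFDerivWithinAt v v' {x | 0 ≤ φ x} z)
    {b : EuclideanSpace ℝ (Fin d)} (hb : 0 < fderiv ℝ φ z b) : v' b < 0 := by
  have hdφ : fderiv ℝ φ z ≠ 0 := fun h => by simp [h] at hb
  have hle' : ∀ x ∈ U, 0 ≤ φ x → v x ≤ v z := fun x hx h => by
    rcases h.eq_or_lt with h | h
    exacts [hle x hx h.symm, (hlt x hx h).le]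
  obtain ⟨A, hA⟩ := exists_barrier_laplacian_pos hG hpos.self_of_nhds hφ hφz hdφ
  set w := barrier φ A z with hw
  have hws : ContDiff ℝ ∞ w := contDiff_barrier hφ A
  have hw2 : ∀ x, ContDiffAt ℝ 2 w x := fun x =>
    hws.contDiffAt.of_le (by norm_cast)
  have hwz : w z = 0 := by simp [hw, barrier, hφz]
  have hw0 : ∀ x, φ x = 0 → w x = -‖x - z‖ ^ 2 := fun x hx => by simp [hw, barrier, hx]
  obtain ⟨ρ, hρ, hball⟩ := Metric.nhds_basis_closedBall.mem_iff.mp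
    (inter_mem hU (hA.and hpos))
  have hSc : IsClosed {x | 0 ≤ φ x} := isClosed_le continuous_const hφ.continuous
  -- On the part of the sphere where `w ≥ 0`, the function `v` stays below its maximum.
  have hsphere : ∃ ε > 0, ∀ x ∈ Metric.sphere z ρ, 0 ≤ φ x → v x + ε * w x ≤ v z := by
    set K := Metric.sphere z ρ ∩ ({x | 0 ≤ φ x} ∩ {x | 0 ≤ w x}) with hK
    have hKc : IsCompact K := (isCompact_sphere z ρ).inter_right
      (hSc.inter (isClosed_le continuous_const hws.continuous))
    have hKU : K ⊆ U := fun x hx => (hball (Metric.sphere_subset_closedBall hx.1)).1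
    have hKφ : ∀ x ∈ K, 0 < φ x := fun x hx => by
      refine lt_of_le_of_ne hx.2.1 fun h => ?_
      have h1 : 0 ≤ w x := hx.2.2
      rw [hw0 x h.symm, ← dist_eq_norm, Metric.mem_sphere.mp hx.1] at h1
      nlinarith
    have hout : ∀ ε > 0, ∀ x ∈ Metric.sphere z ρ, 0 ≤ φ x → x ∉ K → v x + ε * w x ≤ v z := by
      intro ε hε x hx h hxK
      have hwx : w x < 0 := not_le.mp fun h' => hxK ⟨hx, h, h'⟩
      have := hle' x (hball (Metric.sphere_subset_closedBall hx)).1 h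
      nlinarith
    rcases K.eq_empty_or_nonempty with hKe | hKne
    · exact ⟨1, one_pos, fun x hx h => hout 1 one_pos x hx h (by simp [hKe])⟩
    obtain ⟨p, hp, hpmax⟩ := hKc.exists_isMaxOn hKne
      (hvc.mono fun x hx => ⟨hKU hx, hx.2.1⟩)
    obtain ⟨W, hW⟩ := hKc.bddAbove_image hws.continuous.continuousOn
    have hW' : ∀ x ∈ K, w x ≤ W := fun x hx => hW (mem_image_of_mem w hx)
    have hWp : 0 ≤ W := le_trans hp.2.2 (hW' p hp)
    have hgap : 0 < v z - v p := sub_pos.mpr (hlt p (hKU hp) (hKφ p hp))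
    refine ⟨(v z - v p) / (W + 1), by positivity, fun x hx h => ?_⟩
    by_cases hxK : x ∈ K
    · have h1 : v x ≤ v p := hpmax hxK
      have h2 : (v z - v p) / (W + 1) * w x ≤ (v z - v p) / (W + 1) * (W + 1) := by
        gcongr
        linarith [hW' x hxK]
      rw [div_mul_cancel₀ _ (by positivity)] at h2
      linarith
    · exact hout _ (by positivity) x hx h hxK
  obtain ⟨ε, hε, hsph⟩ := hsphere
  -- The weak maximum principle for the strictly subharmonic function `v + ε w` on a half ball.
  have hmain : ∀ x ∈ Metric.closedBall z ρ, 0 ≤ φ x → v x + ε * w x ≤ v z := by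
    set D := Metric.closedBall z ρ ∩ {x | 0 ≤ φ x} with hD
    have hDc : IsCompact D := (isCompact_closedBall z ρ).inter_right hSc
    obtain ⟨p, hp, hpmax⟩ := hDc.exists_isMaxOn
      (f := fun x => v x + ε * w x) ⟨z, by simp [hρ.le], hφz.ge⟩
      ((hvc.mono fun x hx => ⟨(hball hx.1).1, hx.2⟩).add
        (continuous_const.mul hws.continuous).continuousOn)
    suffices hpv : v p + ε * w p ≤ v z from fun x hx h => (hpmax ⟨hx, h⟩).trans hpv
    obtain ⟨hpU, hpA, hpG⟩ := hball hp.1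
    by_cases hps : p ∈ Metric.sphere z ρ
    · exact hsph p hps hp.2
    rcases (show 0 ≤ φ p from hp.2).eq_or_lt with h0 | h0
    · have h1 := hle p hpU h0.symm
      have h2 : ε * w p ≤ 0 := by
        rw [hw0 p h0.symm]
        nlinarith [sq_nonneg ‖p - z‖]
      linarith
    exfalso
    have hpb : p ∈ Metric.ball z ρ := lt_of_le_of_ne hp.1 hps
    have hloc : IsLocalMax (fun x => v x + ε * w x) p := by
      filter_upwards [Metric.isOpen_ball.mem_nhds hpb,
        hφ.continuous.continuousAt.eventually (lt_mem_nhds h0)] with x hx hx'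
      exact hpmax ⟨Metric.ball_subset_closedBall hx, hx'.le⟩
    have hεw : ContDiffAt ℝ 2 (fun x => ε * w x) p := contDiffAt_const.mul (hw2 p)
    have := laplacian_nonpos_of_isLocalMax hpG.inv.posSemidef ((hv2 p hpU h0).add hεw) hloc
    rw [laplacian_add (hv2 p hpU h0) hεw, laplacian_const_mul ε (hw2 p), hlap p hpU h0] at this
    nlinarith [mul_pos hε hpA]
  have hwd : HasFDerivAt w (fderiv ℝ φ z) z := by
    rw [← fderiv_barrier (A := A) hφ hφz]
    exact (hws.differentiable (by simp) z).hasFDerivAt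
  have hlocmax : IsLocalMaxOn (fun x => v x + ε * w x) {x | 0 ≤ φ x} z := by
    filter_upwards [self_mem_nhdsWithin,
      mem_nhdsWithin_of_mem_nhds (Metric.closedBall_mem_nhds z hρ)] with x hx hx'
    simpa [hwz] using hmain x hx' hx
  have hcone : b ∈ posTangentConeAt {x | 0 ≤ φ x} z := by
    refine mem_posTangentConeAt_of_frequently_mem (Eventually.frequently ?_)
    have hline : HasDerivAt (fun t : ℝ => φ (z + t • b)) (fderiv ℝ φ z b) 0 := by
      have h1 : HasDerivAt (fun t : ℝ => z + t • b) b 0 := by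
        simpa using ((hasDerivAt_id (0 : ℝ)).smul_const b).const_add z
      have h2 : HasFDerivAt φ (fderiv ℝ φ z) (z + (0 : ℝ) • b) := by
        simpa using (hφ.differentiable (by simp) z).hasFDerivAt
      exact h2.comp_hasDerivAt 0 h1
    have hs := (hasDerivAt_iff_tendsto_slope.mp hline).eventually (lt_mem_nhds hb)
    filter_upwards [hs.filter_mono (nhdsWithin_mono 0 fun t (ht : 0 < t) => ht.ne'),
      self_mem_nhdsWithin] with t ht ht0
    simp only [slope_def_field, zero_smul, add_zero, hφz, sub_zero] at ht
    exact ((div_pos_iff_of_pos_right ht0).mp ht).le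
  have hfin := hlocmax.hasFDerivWithinAt_nonpos
    (hv'.add ((hwd.const_mul ε).hasFDerivWithinAt)) hcone
  have : v' b + ε * fderiv ℝ φ z b ≤ 0 := by simpa using hfin
  nlinarith [mul_pos hε hb]

end Hopf

/-! ### The curvature tensor -/

section Curvature

variable {G : EuclideanSpace ℝ (Fin d) → Matrix (Fin d) (Fin d) ℝ}
  {z : EuclideanSpace ℝ (Fin d)}

/-- `G` is smooth and positive definite (in particular symmetric) near `z`. -/
def IsMetricNear (G : EuclideanSpace ℝ (Fin d) → Matrix (Fin d) (Fin d) ℝ)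
    (z : EuclideanSpace ℝ (Fin d)) : Prop :=
  ∀ᶠ x in 𝓝 z, (∀ i j, ContDiffAt ℝ ∞ (fun y => G y i j) x) ∧ (G x).PosDef

lemma IsMetricNear.symm (hG : IsMetricNear G z) (i j : Fin d) :
    (fun y => G y i j) =ᶠ[𝓝 z] fun y => G y j i := by
  filter_upwards [hG] with x hx using by simpa using hx.2.1.apply j i

lemma IsMetricNear.contDiffAt_christoffel (hG : IsMetricNear G z) (k i j : Fin d) :
    ContDiffAt ℝ ∞ (christoffel G k i j) z :=
  Coord.contDiffAt_christoffel hG.self_of_nhds.1 hG.self_of_nhds.2.det_pos.ne' k i j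

/-- The Christoffel symbols of the first kind, `⟨D_{∂_i} ∂_j, ∂_a⟩`. -/
def christoffelFirst (G : EuclideanSpace ℝ (Fin d) → Matrix (Fin d) (Fin d) ℝ) (a i j : Fin d)
    (x : EuclideanSpace ℝ (Fin d)) : ℝ :=
  (1 / 2 : ℝ) * (pd i (fun y => G y j a) x + pd j (fun y => G y i a) x - pd a (fun y => G y i j) x)

/-- The Riemann curvature tensor
`R^a_ikl = ∂_k Γ^a_il - ∂_l Γ^a_ik + Σ_p (Γ^a_kp Γ^p_il - Γ^a_lp Γ^p_ik)`. -/
def riemann (G : EuclideanSpace ℝ (Fin d) → Matrix (Fin d) (Fin d) ℝ) (a i k l : Fin d)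
    (x : EuclideanSpace ℝ (Fin d)) : ℝ :=
  pd k (christoffel G a i l) x - pd l (christoffel G a i k) x +
    ∑ p, (christoffel G a k p x * christoffel G p i l x -
      christoffel G a l p x * christoffel G p i k x)

/-- The curvature tensor with all indices lowered, `R_aikl = Σ_b g_ab R^b_ikl`. -/
def riemannLow (G : EuclideanSpace ℝ (Fin d) → Matrix (Fin d) (Fin d) ℝ) (a i k l : Fin d)
    (x : EuclideanSpace ℝ (Fin d)) : ℝ :=
  ∑ b, G x a b * riemann G b i k l x

lemma ricci_eq_sum_riemann (i j : Fin d) : ricci G i j z = ∑ k, riemann G k i k j z := by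
  simp only [ricci, riemann, Finset.sum_add_distrib]

lemma riemann_antisymm_right (a i k l : Fin d) : riemann G a i k l z = -riemann G a i l k z := by
  simp only [riemann, Finset.sum_sub_distrib]
  ring

lemma riemannLow_antisymm_right (a i k l : Fin d) :
    riemannLow G a i k l z = -riemannLow G a i l k z := by
  simp only [riemannLow, fun b => riemann_antisymm_right (G := G)
    (z := z) b i k l, mul_neg, Finset.sum_neg_distrib]

lemma christoffel_eq_sum (k i j : Fin d) :
    christoffel G k i j z = ∑ l, (G z)⁻¹ k l * christoffelFirst G l i j z := by
  simp only [christoffel, christoffelFirst, Finset.mul_sum]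
  exact Finset.sum_congr rfl fun l _ => by ring

lemma sum_mul_christoffel (hG : (G z).det ≠ 0) (a i j : Fin d) :
    ∑ k, G z a k * christoffel G k i j z = christoffelFirst G a i j z := by
  have h := Matrix.mul_nonsing_inv (G z) (isUnit_iff_ne_zero.mpr hG)
  have : (G z) *ᵥ ((G z)⁻¹ *ᵥ fun l => christoffelFirst G l i j z) =
      fun l => christoffelFirst G l i j z := by
    rw [Matrix.mulVec_mulVec, h, Matrix.one_mulVec]
  simp only [christoffel_eq_sum]
  exact congrFun this a

lemma sum_inv_mul_riemannLow (hG : (G z).det ≠ 0) (a i k l : Fin d) :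
    ∑ b, (G z)⁻¹ a b * riemannLow G b i k l z = riemann G a i k l z := by
  have h := Matrix.nonsing_inv_mul (G z) (isUnit_iff_ne_zero.mpr hG)
  have : (G z)⁻¹ *ᵥ ((G z) *ᵥ fun b => riemann G b i k l z) = fun b => riemann G b i k l z := by
    rw [Matrix.mulVec_mulVec, h, Matrix.one_mulVec]
  exact congrFun this a

lemma christoffelFirst_symm (hG : IsMetricNear G z) (a i j : Fin d) :
    christoffelFirst G a i j z = christoffelFirst G a j i z := by
  simp only [christoffelFirst, pd_congr a (hG.symm i j)]
  ring

lemma christoffel_symm (hG : IsMetricNear G z) (a i j : Fin d) :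
    christoffel G a i j z = christoffel G a j i z := by
  simp only [christoffel_eq_sum, fun l => christoffelFirst_symm hG l i j]

/-- The Levi-Civita connection is compatible with the metric. -/
lemma pd_metric (hG : IsMetricNear G z) (k a i : Fin d) :
    pd k (fun y => G y a i) z = christoffelFirst G a k i z + christoffelFirst G i k a z := by
  simp only [christoffelFirst, pd_congr k (hG.symm i a), pd_congr i (hG.symm k a)]
  ring

lemma contDiffAt_christoffelFirst (hG : IsMetricNear G z) (a i j : Fin d) :
    ContDiffAt ℝ ∞ (christoffelFirst G a i j) z := by
  have h := hG.self_of_nhds.1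
  unfold christoffelFirst
  exact contDiffAt_const.mul (((contDiffAt_pd_infty _ (h _ _)).add
    (contDiffAt_pd_infty _ (h _ _))).sub (contDiffAt_pd_infty _ (h _ _)))

/-- The derivative of `Σ_m g_am Γ^m_il = ⟨D_{∂_i} ∂_l, ∂_a⟩`, solved for the term with `∂_k Γ^m_il`. -/
lemma sum_mul_pd_christoffel (hG : IsMetricNear G z) (a i l k : Fin d) :
    ∑ m, G z a m * pd k (christoffel G m i l) z = pd k (christoffelFirst G a i l) z -
      ∑ m, (christoffelFirst G a k m z + christoffelFirst G m k a z) * christoffel G m i l z := by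
  have hd : ∀ m, DifferentiableAt ℝ (fun y => G y a m) z := fun m =>
    (hG.self_of_nhds.1 a m).differentiableAt (by simp)
  have hΓ : ∀ m, DifferentiableAt ℝ (christoffel G m i l) z := fun m =>
    (hG.contDiffAt_christoffel m i l).differentiableAt (by simp)
  have hev : christoffelFirst G a i l =ᶠ[𝓝 z] fun y => ∑ m, G y a m * christoffel G m i l y := by
    filter_upwards [hG] with y hy using (sum_mul_christoffel hy.2.det_pos.ne' a i l).symm
  rw [pd_congr k hev, pd_sum (F := fun m y => G y a m * christoffel G m i l y) _ _
    fun m _ => (hd m).mul (hΓ m), ← Finset.sum_sub_distrib]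
  refine Finset.sum_congr rfl fun m _ => ?_
  rw [pd_mul k (hd m) (hΓ m), pd_metric hG]
  ring

lemma riemannLow_eq (hG : IsMetricNear G z) (a i k l : Fin d) :
    riemannLow G a i k l z =
      pd k (christoffelFirst G a i l) z - pd l (christoffelFirst G a i k) z -
        ∑ m, christoffelFirst G m k a z * christoffel G m i l z +
        ∑ m, christoffelFirst G m l a z * christoffel G m i k z := by
  have hquad : ∀ k l, ∑ b, G z a b * ∑ p, christoffel G b k p z * christoffel G p i l z =
      ∑ p, christoffelFirst G a k p z * christoffel G p i l z := fun k l => by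
    simp only [Finset.mul_sum, ← sum_mul_christoffel hG.self_of_nhds.2.det_pos.ne' a, Finset.sum_mul]
    rw [Finset.sum_comm]
    simp only [mul_assoc]
  have hexp : riemannLow G a i k l z =
      ∑ b, G z a b * pd k (christoffel G b i l) z - ∑ b, G z a b * pd l (christoffel G b i k) z +
      (∑ b, G z a b * ∑ p, christoffel G b k p z * christoffel G p i l z -
        ∑ b, G z a b * ∑ p, christoffel G b l p z * christoffel G p i k z) := by
    simp only [riemannLow, riemann, mul_add, mul_sub, Finset.sum_add_distrib,
      Finset.sum_sub_distrib]
  rw [hexp, hquad, hquad, sum_mul_pd_christoffel hG, sum_mul_pd_christoffel hG]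
  simp only [add_mul, Finset.sum_add_distrib]
  ring

/-- The curvature tensor is skew in its first two indices. -/
lemma riemannLow_antisymm_left (hG : IsMetricNear G z) (a i k l : Fin d) :
    riemannLow G a i k l z = -riemannLow G i a k l z := by
  have hdet := hG.self_of_nhds.2.det_pos.ne'
  -- Both sides are `⟨D_{∂_p} ∂_q, D_{∂_r} ∂_s⟩`.
  have hB : ∀ p q r s : Fin d, ∑ m, christoffelFirst G m p q z * christoffel G m r s z =
      ∑ m, christoffelFirst G m r s z * christoffel G m p q z := fun p q r s => by
    simp only [← sum_mul_christoffel hdet, Finset.sum_mul]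
    rw [Finset.sum_comm]
    refine Finset.sum_congr rfl fun m _ => Finset.sum_congr rfl fun n _ => ?_
    rw [(hG.symm n m).eq_of_nhds]
    ring
  have hd : ∀ a i j, DifferentiableAt ℝ (christoffelFirst G a i j) z := fun a i j =>
    (contDiffAt_christoffelFirst hG a i j).differentiableAt (by simp)
  have hsecond : ∀ k l, pd k (christoffelFirst G a i l) z + pd k (christoffelFirst G i a l) z =
      pd k (pd l fun y => G y a i) z := fun k l => by
    rw [← pd_add k (hd _ _ _) (hd _ _ _)]
    refine pd_congr k ?_
    filter_upwards [hG.eventually_nhds] with y hy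
    rw [pd_metric hy, christoffelFirst_symm hy a i l, christoffelFirst_symm hy i a l]
  have hcomm := pd_comm k l ((hG.self_of_nhds.1 a i).of_le (by norm_cast) : ContDiffAt ℝ 2 _ z)
  have h1 := hB k a i l
  have h2 := hB l a i k
  have e1 : ∀ p q r s : Fin d, ∑ m, christoffelFirst G m p q z * christoffel G m r s z =
      ∑ m, christoffelFirst G m q p z * christoffel G m s r z := fun p q r s =>
    Finset.sum_congr rfl fun m _ => by
      rw [christoffelFirst_symm hG m p q, christoffel_symm hG m r s]
  rw [riemannLow_eq hG, riemannLow_eq hG, h1, h2, e1 i l, e1 i k]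
  linarith [hsecond k l, hsecond l k]

end Curvature

/-! ### The Gauss equation for a totally geodesic hypersurface -/

section Gauss

variable {m : ℕ} {G : EuclideanSpace ℝ (Fin (m + 1)) → Matrix (Fin (m + 1)) (Fin (m + 1)) ℝ}

/-- The inclusion of the hyperplane `{x 0 = 0}`. -/
def hyperplaneIncl (m : ℕ) : EuclideanSpace ℝ (Fin m) →L[ℝ] EuclideanSpace ℝ (Fin (m + 1)) :=
  LinearMap.toContinuousLinearMap
    { toFun := fun y => WithLp.toLp 2 (Fin.cons 0 y.ofLp : Fin (m + 1) → ℝ)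
      map_add' := fun x y => by
        ext i
        refine Fin.cases ?_ (fun j => ?_) i <;> simp
      map_smul' := fun c y => by
        ext i
        refine Fin.cases ?_ (fun j => ?_) i <;> simp }

lemma hyperplaneIncl_apply (y : EuclideanSpace ℝ (Fin m)) :
    hyperplaneIncl m y = WithLp.toLp 2 (Fin.cons 0 y.ofLp : Fin (m + 1) → ℝ) := rfl

lemma hyperplaneIncl_single (k : Fin m) :
    hyperplaneIncl m (EuclideanSpace.single k 1) = EuclideanSpace.single k.succ 1 := by
  ext i
  refine Fin.cases ?_ (fun j => ?_) i
  · simp [hyperplaneIncl_apply]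
  · simp [hyperplaneIncl_apply, Pi.single_apply]

lemma pd_comp_hyperplaneIncl {f : EuclideanSpace ℝ (Fin (m + 1)) → ℝ} (k : Fin m)
    {y : EuclideanSpace ℝ (Fin m)} (hf : DifferentiableAt ℝ f (hyperplaneIncl m y)) :
    pd k (fun y => f (hyperplaneIncl m y)) y = pd k.succ f (hyperplaneIncl m y) := by
  have h : HasFDerivAt (fun y => f (hyperplaneIncl m y)) _ y :=
    hf.hasFDerivAt.comp y (hyperplaneIncl m).hasFDerivAt
  rw [pd, h.fderiv, ContinuousLinearMap.comp_apply, hyperplaneIncl_single, pd]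

/-- The tensor `g^ij - g^i0 g^0j / g^00`: the inverse of the metric induced on `{x 0 = 0}`, extended by
zero to the normal direction. -/
def tangentialInv (A : Matrix (Fin (m + 1)) (Fin (m + 1)) ℝ) (i j : Fin (m + 1)) : ℝ :=
  A⁻¹ i j - A⁻¹ i 0 * A⁻¹ 0 j / A⁻¹ 0 0

lemma tangentialInv_zero_left {A : Matrix (Fin (m + 1)) (Fin (m + 1)) ℝ} (h : A⁻¹ 0 0 ≠ 0)
    (j : Fin (m + 1)) : tangentialInv A 0 j = 0 := by
  simp [tangentialInv, h]

lemma tangentialInv_zero_right {A : Matrix (Fin (m + 1)) (Fin (m + 1)) ℝ} (h : A⁻¹ 0 0 ≠ 0)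
    (j : Fin (m + 1)) : tangentialInv A j 0 = 0 := by
  simp [tangentialInv, h]

lemma inv_submatrix_succ {A : Matrix (Fin (m + 1)) (Fin (m + 1)) ℝ} (hA : A.PosDef) (i j : Fin m) :
    (Matrix.of fun i j : Fin m => A i.succ j.succ)⁻¹ i j = tangentialInv A i.succ j.succ := by
  have h0 : A⁻¹ 0 0 ≠ 0 := hA.inv.diag_pos.ne'
  have hinv : A * A⁻¹ = 1 := Matrix.mul_nonsing_inv A (isUnit_iff_ne_zero.mpr hA.det_pos.ne')
  have hentry : ∀ a b, ∑ l, A a l * A⁻¹ l b = if a = b then 1 else 0 := fun a b => by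
    rw [← Matrix.mul_apply, hinv, Matrix.one_apply]
  rw [Matrix.inv_eq_right_inv (B := Matrix.of fun i j : Fin m => tangentialInv A i.succ j.succ) ?_]
  · rfl
  ext a b
  have h1 : ∑ l, A a.succ l * tangentialInv A l b.succ = if a = b then 1 else 0 := by
    have : ∀ l, A a.succ l * tangentialInv A l b.succ =
        A a.succ l * A⁻¹ l b.succ - A a.succ l * A⁻¹ l 0 * (A⁻¹ 0 b.succ / A⁻¹ 0 0) := fun l => by
      simp only [tangentialInv]
      ring
    simp only [this, Finset.sum_sub_distrib, ← Finset.sum_mul, hentry]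
    simp
  rw [Fin.sum_univ_succ, tangentialInv_zero_left h0] at h1
  simpa [Matrix.mul_apply, Matrix.one_apply] using h1

/-- Contracting the normal component `R^0_i0j` of the curvature with the inverse induced metric gives
a multiple of the Ricci curvature: the correction term `g^i0 g^0j / g^00` drops out because the
curvature tensor is skew in its first two indices. -/
lemma sum_tangentialInv_mul_riemann {z : EuclideanSpace ℝ (Fin (m + 1))} (hG : IsMetricNear G z)
    (hric : ∀ i j, ricci G i j z = 0) :
    ∑ i, ∑ j, tangentialInv (G z) i j * riemann G 0 i 0 j z = 0 := by
  obtain ⟨-, hpos⟩ := hG.self_of_nhds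
  have hdet := hpos.det_pos.ne'
  have hsymm : ∀ i j, (G z)⁻¹ i j = (G z)⁻¹ j i := fun i j => by simpa using hpos.inv.1.apply j i
  have h1 : ∑ i, ∑ j, (G z)⁻¹ i j * riemann G 0 i 0 j z = 0 := by
    have hkey : ∀ i j, (G z)⁻¹ i j * riemann G 0 i 0 j z =
        ∑ a, (G z)⁻¹ 0 a * ((G z)⁻¹ j i * riemannLow G i a j 0 z) := fun i j => by
      rw [← sum_inv_mul_riemannLow hdet, Finset.mul_sum]
      refine Finset.sum_congr rfl fun a _ => ?_
      rw [riemannLow_antisymm_left hG, riemannLow_antisymm_right, hsymm i j]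
      ring
    have hcontr : ∀ a, ∑ j, ∑ i, (G z)⁻¹ j i * riemannLow G i a j 0 z = 0 := fun a => by
      simp only [sum_inv_mul_riemannLow hdet]
      rw [← ricci_eq_sum_riemann, hric]
    calc ∑ i, ∑ j, (G z)⁻¹ i j * riemann G 0 i 0 j z
        = ∑ j, ∑ i, ∑ a, (G z)⁻¹ 0 a * ((G z)⁻¹ j i * riemannLow G i a j 0 z) := by
          rw [Finset.sum_comm]
          simp only [hkey]
      _ = ∑ a, (G z)⁻¹ 0 a * ∑ j, ∑ i, (G z)⁻¹ j i * riemannLow G i a j 0 z := by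
          simp only [Finset.mul_sum]
          symm
          rw [Finset.sum_comm]
          refine Finset.sum_congr rfl fun j _ => ?_
          rw [Finset.sum_comm]
      _ = 0 := by simp [hcontr]
  have h2 : ∀ j, ∑ i, (G z)⁻¹ i 0 * riemann G 0 i 0 j z = 0 := fun j => by
    set S := ∑ i, (G z)⁻¹ i 0 * riemann G 0 i 0 j z with hS
    have hS1 : S = ∑ i, ∑ a, (G z)⁻¹ 0 i * (G z)⁻¹ 0 a * riemannLow G a i 0 j z := by
      simp only [hS, ← sum_inv_mul_riemannLow hdet, Finset.mul_sum, hsymm _ 0, mul_assoc]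
    have hS2 : S = -S := by
      conv_lhs => rw [hS1, Finset.sum_comm]
      rw [hS1, ← Finset.sum_neg_distrib]
      refine Finset.sum_congr rfl fun i _ => ?_
      rw [← Finset.sum_neg_distrib]
      refine Finset.sum_congr rfl fun a _ => ?_
      rw [riemannLow_antisymm_left hG i a]
      ring
    linarith
  have hsplit : ∀ i j, tangentialInv (G z) i j * riemann G 0 i 0 j z =
      (G z)⁻¹ i j * riemann G 0 i 0 j z -
        (G z)⁻¹ 0 j / (G z)⁻¹ 0 0 * ((G z)⁻¹ i 0 * riemann G 0 i 0 j z) := fun i j => by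
    simp only [tangentialInv]
    ring
  simp only [hsplit, Finset.sum_sub_distrib, h1, zero_sub]
  rw [Finset.sum_comm]
  simp [← Finset.mul_sum, h2]

/-- For a totally geodesic hyperplane the Christoffel symbols of the induced metric are the tangential
Christoffel symbols of the ambient metric. -/
lemma christoffel_induced {y : EuclideanSpace ℝ (Fin m)} (hG : IsMetricNear G (hyperplaneIncl m y))
    {i j : Fin m} (hΓ : christoffel G 0 i.succ j.succ (hyperplaneIncl m y) = 0) (k : Fin m) :
    christoffel (fun y => Matrix.of fun i j : Fin m => G (hyperplaneIncl m y) i.succ j.succ) k i j y =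
      christoffel G k.succ i.succ j.succ (hyperplaneIncl m y) := by
  obtain ⟨hsm, hpos⟩ := hG.self_of_nhds
  have h0 : (G (hyperplaneIncl m y))⁻¹ 0 0 ≠ 0 := hpos.inv.diag_pos.ne'
  have hfirst : ∀ l, christoffelFirst
      (fun y => Matrix.of fun i j : Fin m => G (hyperplaneIncl m y) i.succ j.succ) l i j y =
      christoffelFirst G l.succ i.succ j.succ (hyperplaneIncl m y) := fun l => by
    have hpd : ∀ k a b : Fin m, pd k (fun y => G (hyperplaneIncl m y) a.succ b.succ) y =
        pd k.succ (fun x => G x a.succ b.succ) (hyperplaneIncl m y) := fun k a b =>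
      pd_comp_hyperplaneIncl (f := fun x => G x a.succ b.succ) k
        ((hsm _ _).differentiableAt (by simp))
    simp only [christoffelFirst, Matrix.of_apply, hpd]
  rw [christoffel_eq_sum]
  simp only [inv_submatrix_succ hpos, hfirst]
  have hall : ∑ l, tangentialInv (G (hyperplaneIncl m y)) k.succ l *
      christoffelFirst G l i.succ j.succ (hyperplaneIncl m y) =
      christoffel G k.succ i.succ j.succ (hyperplaneIncl m y) := by
    have : ∀ l, tangentialInv (G (hyperplaneIncl m y)) k.succ l *
        christoffelFirst G l i.succ j.succ (hyperplaneIncl m y) =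
        (G (hyperplaneIncl m y))⁻¹ k.succ l *
          christoffelFirst G l i.succ j.succ (hyperplaneIncl m y) -
        (G (hyperplaneIncl m y))⁻¹ k.succ 0 / (G (hyperplaneIncl m y))⁻¹ 0 0 *
          ((G (hyperplaneIncl m y))⁻¹ 0 l *
            christoffelFirst G l i.succ j.succ (hyperplaneIncl m y)) := fun l => by
      simp only [tangentialInv]
      ring
    simp only [this, Finset.sum_sub_distrib, ← Finset.mul_sum, ← christoffel_eq_sum, hΓ]
    simp
  rw [Fin.sum_univ_succ, tangentialInv_zero_right h0] at hall
  simpa using hall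

/-- The Gauss equation: a totally geodesic hyperplane of a metric that is Ricci flat along it is scalar
flat. -/
theorem scalar_induced_eq_zero {y : EuclideanSpace ℝ (Fin m)}
    (hG : IsMetricNear G (hyperplaneIncl m y))
    (hΓ : ∀ᶠ y' in 𝓝 y, ∀ i j : Fin m,
      christoffel G 0 i.succ j.succ (hyperplaneIncl m y') = 0)
    (hric : ∀ i j, ricci G i j (hyperplaneIncl m y) = 0) :
    scalar (fun y => Matrix.of fun i j : Fin m => G (hyperplaneIncl m y) i.succ j.succ) y = 0 := by
  set Gh : EuclideanSpace ℝ (Fin m) → Matrix (Fin m) (Fin m) ℝ :=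
    fun y => Matrix.of fun i j : Fin m => G (hyperplaneIncl m y) i.succ j.succ with hGh
  obtain ⟨hsm, hpos⟩ := hG.self_of_nhds
  have h0 : (G (hyperplaneIncl m y))⁻¹ 0 0 ≠ 0 := hpos.inv.diag_pos.ne'
  have hnear : ∀ᶠ y' in 𝓝 y, IsMetricNear G (hyperplaneIncl m y') :=
    (hyperplaneIncl m).continuous.continuousAt.eventually hG.eventually_nhds
  have hchr : ∀ k i j : Fin m, christoffel Gh k i j =ᶠ[𝓝 y]
      fun y' => christoffel G k.succ i.succ j.succ (hyperplaneIncl m y') := fun k i j => by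
    filter_upwards [hnear, hΓ] with y' h1 h2 using christoffel_induced h1 (h2 i j) k
  have hpd : ∀ l k i j : Fin m, pd l (christoffel Gh k i j) y =
      pd l.succ (christoffel G k.succ i.succ j.succ) (hyperplaneIncl m y) := fun l k i j => by
    rw [pd_congr l (hchr k i j), pd_comp_hyperplaneIncl l]
    exact (hG.contDiffAt_christoffel _ _ _).differentiableAt (by simp)
  have hΓ0 := hΓ.self_of_nhds
  have hricci : ∀ i j : Fin m,
      ricci Gh i j y = -riemann G 0 i.succ 0 j.succ (hyperplaneIncl m y) := fun i j => by
    have hfull := hric i.succ j.succ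
    have htan : ∀ k : Fin m, riemann Gh k i k j y =
        riemann G k.succ i.succ k.succ j.succ (hyperplaneIncl m y) := fun k => by
      simp only [riemann, Fin.sum_univ_succ, hpd, (hchr _ _ _).eq_of_nhds, hΓ0]
      ring
    rw [ricci_eq_sum_riemann, Fin.sum_univ_succ] at hfull
    rw [ricci_eq_sum_riemann]
    simp only [htan]
    linarith
  have hcontr := sum_tangentialInv_mul_riemann hG hric
  simp only [Fin.sum_univ_succ (n := m), tangentialInv_zero_left h0,
    tangentialInv_zero_right h0, zero_mul, Finset.sum_const_zero, zero_add] at hcontr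
  simp only [scalar, hGh, inv_submatrix_succ hpos]
  simp only [← hGh, hricci, mul_neg, Finset.sum_neg_distrib, hcontr, neg_zero]

end Gauss

end Coord

namespace StaticBoundary

variable {m : ℕ} {M : Type*} [TopologicalSpace M]
  [ChartedSpace (EuclideanSpace ℝ (Fin (m + 1))) M]
  [IsManifold 𝓘(ℝ, EuclideanSpace ℝ (Fin (m + 1))) ∞ M]

/-! ### The metric in a chart -/

section Chart

variable {e : OpenPartialHomeomorph M (EuclideanSpace ℝ (Fin (m + 1)))}
  {x : EuclideanSpace ℝ (Fin (m + 1))}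

lemma contDiffAt_metricCoeff (g : SmoothMetric m M) (he : IsSmoothChart e) (hx : x ∈ e.target)
    (i j : Fin (m + 1)) : ContDiffAt ℝ ∞ (fun y => metricCoeff g e y i j) x := by
  have hsymm : ContMDiffOn 𝓘(ℝ, EuclideanSpace ℝ (Fin (m + 1)))
      𝓘(ℝ, EuclideanSpace ℝ (Fin (m + 1))) ∞ e.symm e.target :=
    contMDiffOn_symm_of_mem_maximalAtlas he
  have hT := hsymm.contMDiffOn_tangentMapWithin (m := ∞) (by simp) e.open_target.uniqueMDiffOn
  -- The coordinate fields `∂_k` are smooth sections of the tangent bundle along `e.symm`.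
  have hfield : ∀ v : EuclideanSpace ℝ (Fin (m + 1)),
      ContMDiffAt 𝓘(ℝ, EuclideanSpace ℝ (Fin (m + 1)))
        (𝓘(ℝ, EuclideanSpace ℝ (Fin (m + 1))).prod 𝓘(ℝ, EuclideanSpace ℝ (Fin (m + 1)))) ∞
        (fun y => (Bundle.TotalSpace.mk' (EuclideanSpace ℝ (Fin (m + 1))) (e.symm y)
          (mfderiv 𝓘(ℝ, EuclideanSpace ℝ (Fin (m + 1))) 𝓘(ℝ, EuclideanSpace ℝ (Fin (m + 1)))
            e.symm y v) : TangentBundle 𝓘(ℝ, EuclideanSpace ℝ (Fin (m + 1))) M)) x := by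
    intro v
    have hconst : ContMDiff 𝓘(ℝ, EuclideanSpace ℝ (Fin (m + 1)))
        (𝓘(ℝ, EuclideanSpace ℝ (Fin (m + 1))).prod 𝓘(ℝ, EuclideanSpace ℝ (Fin (m + 1)))) ∞
        (fun y => (⟨y, v⟩ : TangentBundle 𝓘(ℝ, EuclideanSpace ℝ (Fin (m + 1)))
          (EuclideanSpace ℝ (Fin (m + 1))))) := by
      exact contMDiff_vectorSpace_iff_contDiff.mpr contDiff_const
    have hcomp := hT.comp (hconst.contMDiffOn (s := e.target)) (fun y hy => hy)
    refine (hcomp.contMDiffAt (e.open_target.mem_nhds hx)).congr_of_eventuallyEq ?_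
    filter_upwards [e.open_target.mem_nhds hx] with y hy
    simp [tangentMapWithin, mfderivWithin_of_isOpen e.open_target hy]
  have hg : ContMDiffAt 𝓘(ℝ, EuclideanSpace ℝ (Fin (m + 1))) _ ∞ _ x :=
    (g.contMDiff.contMDiffAt (x := e.symm x)).comp x
      (hsymm.contMDiffAt (e.open_target.mem_nhds hx))
  have := hg.clm_bundle_apply₂ (F₁ := EuclideanSpace ℝ (Fin (m + 1)))
    (F₂ := EuclideanSpace ℝ (Fin (m + 1))) (E₃ := Bundle.Trivial M ℝ)
    (hfield (EuclideanSpace.single i 1)) (hfield (EuclideanSpace.single j 1))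
  rw [Bundle.contMDiffAt_totalSpace] at this
  exact this.2.contDiffAt

lemma posDef_metricCoeff (g : SmoothMetric m M) (he : IsSmoothChart e) (hx : x ∈ e.target) :
    (metricCoeff g e x).PosDef := by
  have hs : MDifferentiableAt 𝓘(ℝ, EuclideanSpace ℝ (Fin (m + 1)))
      𝓘(ℝ, EuclideanSpace ℝ (Fin (m + 1))) e.symm x :=
    (contMDiffAt_symm_of_mem_maximalAtlas he hx).mdifferentiableAt (by simp)
  have hd : MDifferentiableAt 𝓘(ℝ, EuclideanSpace ℝ (Fin (m + 1)))
      𝓘(ℝ, EuclideanSpace ℝ (Fin (m + 1))) e (e.symm x) :=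
    (contMDiffAt_of_mem_maximalAtlas he (e.map_target hx)).mdifferentiableAt (by simp)
  set T := mfderiv 𝓘(ℝ, EuclideanSpace ℝ (Fin (m + 1))) 𝓘(ℝ, EuclideanSpace ℝ (Fin (m + 1)))
    e.symm x with hT
  -- The differential of `e.symm` is injective, as `e ∘ e.symm` is the identity near `x`.
  have hinj : ∀ v : EuclideanSpace ℝ (Fin (m + 1)), T v = 0 → v = 0 := by
    intro v hv
    have hcomp := mfderiv_comp x hd hs
    have hid : (e ∘ e.symm) =ᶠ[𝓝 x] id := by
      filter_upwards [e.open_target.mem_nhds hx] with y hy using e.right_inv hy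
    rw [hid.mfderiv_eq, mfderiv_id] at hcomp
    have := congrArg (fun L => L v) hcomp
    rw [← hT] at this
    have h2 : v = mfderiv 𝓘(ℝ, EuclideanSpace ℝ (Fin (m + 1))) 𝓘(ℝ, EuclideanSpace ℝ (Fin (m + 1)))
      e (e.symm x) (T v) := this
    rw [h2, hv, map_zero]
    rfl
  have hvec : ∀ c : Fin (m + 1) → ℝ, T (WithLp.toLp 2 c : EuclideanSpace ℝ (Fin (m + 1))) =
      ∑ i, c i • T (EuclideanSpace.single i (1 : ℝ)) := by
    intro c
    have hc : (WithLp.toLp 2 c : EuclideanSpace ℝ (Fin (m + 1))) =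
        ∑ i, c i • EuclideanSpace.single i (1 : ℝ) := by
      ext j
      simp [Pi.single_apply]
    rw [hc]
    exact (map_sum T _ _).trans (Finset.sum_congr rfl fun i _ => map_smul T _ _)
  refine Matrix.PosDef.of_dotProduct_mulVec_pos ?_ fun c hc => ?_
  · ext i j
    exact g.symm _ _ _
  · have hne : T (WithLp.toLp 2 c : EuclideanSpace ℝ (Fin (m + 1))) ≠ 0 := fun h =>
      hc (by simpa using hinj _ h)
    have hpos := g.pos _ _ hne
    rw [hvec c] at hpos
    simp only [map_sum, map_smul, _root_.sum_apply, _root_.smul_apply,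
      smul_eq_mul] at hpos
    refine hpos.trans_eq ?_
    simp only [dotProduct, Matrix.mulVec, Pi.star_apply, star_trivial, Finset.mul_sum, metricCoeff,
      Matrix.of_apply]
    rw [Finset.sum_comm]
    refine Finset.sum_congr rfl fun i _ => Finset.sum_congr rfl fun j _ => ?_
    ring

end Chart

end StaticBoundary

namespace Coord

/-! ### The strong maximum principle -/

/-- A harmonic function with a local maximum is locally constant: otherwise some ball in the set where
`v` is smaller than its maximum touches the maximum set, and the Hopf lemma at the point of contact
contradicts the vanishing of the gradient there. -/
theorem eventually_eq_of_harmonic_of_isLocalMax {d : ℕ}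
    {G : EuclideanSpace ℝ (Fin d) → Matrix (Fin d) (Fin d) ℝ} {c : EuclideanSpace ℝ (Fin d)}
    {v : EuclideanSpace ℝ (Fin d) → ℝ}
    (h : ∀ᶠ y in 𝓝 c, IsMetricNear G y ∧ ContDiffAt ℝ 2 v y ∧ laplacian G v y = 0)
    (hmax : IsLocalMax v c) : ∀ᶠ y in 𝓝 c, v y = v c := by
  obtain ⟨R, hR, hball⟩ := Metric.nhds_basis_ball.mem_iff.mp (inter_mem h hmax)
  set r := R / 3 with hr
  have hr0 : 0 < r := by positivity
  have hsub : Metric.closedBall c (2 * r) ⊆ Metric.ball c R :=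
    Metric.closedBall_subset_ball (by linarith)
  have hvc : ContinuousOn v (Metric.closedBall c (2 * r)) := fun x hx =>
    (hball (hsub hx)).1.2.1.continuousAt.continuousWithinAt
  filter_upwards [Metric.ball_mem_nhds c hr0] with y hy
  by_contra hne
  set F := Metric.closedBall c (2 * r) ∩ v ⁻¹' {v c} with hF
  have hFc : IsCompact F := (isCompact_closedBall c (2 * r)).of_isClosed_subset
    (hvc.preimage_isClosed_of_isClosed Metric.isClosed_closedBall isClosed_singleton)
    inter_subset_left
  have hcF : c ∈ F := ⟨by simp [hr0.le], rfl⟩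
  obtain ⟨z, hzF, hz⟩ := hFc.exists_infDist_eq_dist ⟨c, hcF⟩ y
  have hnear : ∀ x ∈ F, dist y z ≤ dist y x := fun x hx => hz ▸ Metric.infDist_le_dist_of_mem hx
  have hvz : v z = v c := hzF.2
  have hzb : z ∈ Metric.ball c (2 * r) := by
    have h1 := hnear c hcF
    have h2 := dist_triangle z y c
    rw [dist_comm z y] at h2
    rw [Metric.mem_ball] at hy ⊢
    linarith
  have hzy : 0 < ‖z - y‖ := norm_pos_iff.mpr (sub_ne_zero.mpr fun h => hne (h ▸ hvz))
  -- The ball `{0 < φ}` around `y` touches the maximum set `F` at `z` and does not meet it.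
  set φ : EuclideanSpace ℝ (Fin d) → ℝ := fun x => ‖z - y‖ ^ 2 - ‖x - y‖ ^ 2 with hφ
  have hφs : ContDiff ℝ ∞ φ :=
    contDiff_const.sub ((contDiff_id.sub contDiff_const).norm_sq ℝ)
  have hbR : ∀ x ∈ Metric.ball c (2 * r), x ∈ Metric.ball c R := fun x hx =>
    hsub (Metric.ball_subset_closedBall hx)
  have hle : ∀ x ∈ Metric.ball c (2 * r), v x ≤ v z := fun x hx => hvz ▸ (hball (hbR x hx)).2
  have hlt : ∀ x ∈ Metric.ball c (2 * r), 0 < φ x → v x < v z := fun x hx h => by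
    refine lt_of_le_of_ne (hle x hx) fun heq => ?_
    have h1 := hnear x ⟨Metric.ball_subset_closedBall hx, heq.trans hvz⟩
    rw [dist_comm, dist_eq_norm, dist_comm, dist_eq_norm] at h1
    have h2 : ‖x - y‖ ^ 2 < ‖z - y‖ ^ 2 := sub_pos.mp h
    nlinarith [norm_nonneg (x - y)]
  obtain ⟨⟨hzG, hz2, -⟩, -⟩ := hball (hbR z hzb)
  have hzmax : IsLocalMax v z := by
    filter_upwards [Metric.isOpen_ball.mem_nhds hzb] with x hx using hle x hx
  have hdv : HasFDerivAt v (0 : EuclideanSpace ℝ (Fin d) →L[ℝ] ℝ) z := by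
    rw [← hzmax.fderiv_eq_zero]
    exact (hz2.differentiableAt two_ne_zero).hasFDerivAt
  have hdφ : HasFDerivAt φ _ z :=
    (((hasFDerivAt_id z).sub_const y).norm_sq).const_sub (‖z - y‖ ^ 2)
  have hb : 0 < fderiv ℝ φ z (y - z) := by
    have h1 : inner ℝ (z - y) (y - z) = -‖z - y‖ ^ 2 := by
      rw [← neg_sub z y, inner_neg_right, real_inner_self_eq_norm_sq]
    rw [hdφ.fderiv]
    simp only [ContinuousLinearMap.comp_id, _root_.neg_apply, _root_.smul_apply, innerSL_apply_apply,
      id, h1]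
    simp
    positivity
  have := hasFDerivWithinAt_neg_of_harmonic hzG.self_of_nhds.1
    (hzG.mono fun x hx => hx.2) hφs (by simp [hφ]) (Metric.isOpen_ball.mem_nhds hzb)
    (fun x hx _ => (hball (hbR x hx)).1.2.1)
    (hvc.mono fun x hx => Metric.ball_subset_closedBall hx.1)
    (fun x hx _ => (hball (hbR x hx)).1.2.2) hlt (fun x hx _ => hle x hx)
    hdv.hasFDerivWithinAt hb
  simp at this

end Coord

namespace StaticBoundary

/-! ### Boundary charts -/

lemma hyperplaneIncl_boundaryCoord {m : ℕ} {M : Type*} [TopologicalSpace M]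
    {e : OpenPartialHomeomorph M (EuclideanSpace ℝ (Fin (m + 1)))} {p : M} (h0 : e p 0 = 0) :
    Coord.hyperplaneIncl m (boundaryCoord e p) = e p := by
  ext i
  refine Fin.cases ?_ (fun j => ?_) i
  · simp [Coord.hyperplaneIncl_apply, h0]
  · simp [Coord.hyperplaneIncl_apply, boundaryCoord]

variable {m : ℕ} {M : Type*} [TopologicalSpace M]
  [ChartedSpace (EuclideanSpace ℝ (Fin (m + 1))) M]

section BoundaryChart

variable {e : OpenPartialHomeomorph M (EuclideanSpace ℝ (Fin (m + 1)))} {Ω : Set M}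
  {x : EuclideanSpace ℝ (Fin (m + 1))} {p : M}

lemma IsBoundaryChart.symm_mem_iff (he : IsBoundaryChart Ω e) (hx : x ∈ e.target) :
    e.symm x ∈ Ω ↔ 0 < x 0 := by
  rw [he.2 _ (e.map_target hx), e.right_inv hx]

/-- Points of the half-space `{0 ≤ x 0}` are limits of points with `0 < x 0`. -/
lemma tendsto_add_single (x : EuclideanSpace ℝ (Fin (m + 1))) :
    Tendsto (fun t : ℝ => x + t • EuclideanSpace.single (0 : Fin (m + 1)) (1 : ℝ)) (𝓝[>] 0)
      (𝓝 x) := by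
  have : Continuous fun t : ℝ => x + t • EuclideanSpace.single (0 : Fin (m + 1)) (1 : ℝ) := by
    fun_prop
  have h := this.tendsto 0
  simp only [zero_smul, add_zero] at h
  exact h.mono_left nhdsWithin_le_nhds

lemma IsBoundaryChart.symm_mem_closure (he : IsBoundaryChart Ω e) (hx : x ∈ e.target)
    (h0 : 0 ≤ x 0) : e.symm x ∈ closure Ω := by
  have hlim := ((e.continuousAt_symm hx).tendsto).comp (tendsto_add_single x)
  refine mem_closure_of_tendsto hlim ?_
  filter_upwards [(tendsto_add_single x).eventually (e.open_target.mem_nhds hx),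
    self_mem_nhdsWithin] with t ht ht0
  refine (he.symm_mem_iff ht).mpr ?_
  have : 0 < t := ht0
  simp
  linarith

lemma IsBoundaryChart.coord_nonneg (he : IsBoundaryChart Ω e) (hp : p ∈ e.source)
    (hpc : p ∈ closure Ω) : 0 ≤ e p 0 := by
  by_contra! hneg
  have hc : ContinuousAt (fun q => e q 0) p :=
    (EuclideanSpace.proj (𝕜 := ℝ) (0 : Fin (m + 1))).continuous.continuousAt.comp
      (e.continuousAt hp)
  obtain ⟨q, ⟨hq, hqs⟩, hqΩ⟩ := mem_closure_iff_nhds.mp hpc _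
    (inter_mem (hc.eventually (gt_mem_nhds hneg)) (e.open_source.mem_nhds hp))
  exact absurd ((he.2 q hqs).mp hqΩ) (not_lt.mpr (le_of_lt hq))

lemma IsBoundaryChart.coord_eq_zero (he : IsBoundaryChart Ω e) (hΩ : IsOpen Ω) (hp : p ∈ e.source)
    (hpf : p ∈ frontier Ω) : e p 0 = 0 := by
  refine le_antisymm (not_lt.mp fun h => ?_) (he.coord_nonneg hp (frontier_subset_closure hpf))
  rw [hΩ.frontier_eq] at hpf
  exact hpf.2 ((he.2 p hp).mpr h)

lemma IsBoundaryChart.symm_mem_frontier (he : IsBoundaryChart Ω e) (hΩ : IsOpen Ω)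
    (hx : x ∈ e.target) (h0 : x 0 = 0) : e.symm x ∈ frontier Ω := by
  rw [hΩ.frontier_eq]
  exact ⟨he.symm_mem_closure hx h0.ge, fun h => by
    simpa [h0] using (he.symm_mem_iff hx).mp h⟩

end BoundaryChart

variable [IsManifold 𝓘(ℝ, EuclideanSpace ℝ (Fin (m + 1))) ∞ M]

/-! ### Static potentials -/

section Potential

variable {g : SmoothMetric m M} {e : OpenPartialHomeomorph M (EuclideanSpace ℝ (Fin (m + 1)))}
  {Ω : Set M} {u : M → ℝ} {x : EuclideanSpace ℝ (Fin (m + 1))} {p : M}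

lemma isMetricNear_metricCoeff (g : SmoothMetric m M) (he : IsSmoothChart e) (hx : x ∈ e.target) :
    Coord.IsMetricNear (metricCoeff g e) x := by
  filter_upwards [e.open_target.mem_nhds hx] with y hy
  exact ⟨contDiffAt_metricCoeff g he hy, posDef_metricCoeff g he hy⟩

lemma inducedCoeff_eq (g : SmoothMetric m M)
    (e : OpenPartialHomeomorph M (EuclideanSpace ℝ (Fin (m + 1)))) :
    inducedCoeff g e = fun y => Matrix.of fun i j : Fin m =>
      metricCoeff g e (Coord.hyperplaneIncl m y) i.succ j.succ := rfl

lemma posDef_inducedCoeff (g : SmoothMetric m M) (he : IsSmoothChart e) (hp : p ∈ e.source)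
    (h0 : e p 0 = 0) : (inducedCoeff g e (boundaryCoord e p)).PosDef := by
  rw [inducedCoeff_eq]
  simp only [hyperplaneIncl_boundaryCoord h0]
  exact (posDef_metricCoeff g he (e.map_source hp)).submatrix (Fin.succ_injective m)

lemma sum_inv_mul_self {n : ℕ} {A : Matrix (Fin n) (Fin n) ℝ} (hA : A.PosDef) :
    ∑ i, ∑ j, A⁻¹ i j * A i j = n := by
  have h := congrArg Matrix.trace
    (Matrix.nonsing_inv_mul A (isUnit_iff_ne_zero.mpr hA.det_pos.ne'))
  simp only [Matrix.trace, Matrix.diag_apply, Matrix.mul_apply, Matrix.one_apply_eq,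
    Finset.sum_const, Finset.card_univ, Fintype.card_fin, nsmul_eq_mul, mul_one] at h
  rw [← h]
  refine Finset.sum_congr rfl fun i _ => Finset.sum_congr rfl fun j _ => ?_
  rw [show A i j = A j i by simpa using hA.1.apply j i]

/-- The trace of the static equation: a static potential is harmonic where `R = 0`. -/
lemma IsStaticPotential.laplacian_eq_zero (hm : 1 ≤ m) (hu : IsStaticPotential g Ω u)
    (he : IsSmoothChart e) (hp : p ∈ e.source ∩ Ω) (hR : scalarCurvature g e p = 0) :
    Coord.laplacian (metricCoeff g e) (u ∘ e.symm) (e p) = 0 := by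
  set Δ := Coord.laplacian (metricCoeff g e) (u ∘ e.symm) (e p) with hΔ
  have hpos := posDef_metricCoeff g he (e.map_source hp.1)
  have htr : ∑ i, ∑ j, (metricCoeff g e (e p))⁻¹ i j * staticOp g e u p i j =
      -Δ * ∑ i, ∑ j, (metricCoeff g e (e p))⁻¹ i j * metricCoeff g e (e p) i j + Δ -
        u p * scalarCurvature g e p := by
    simp only [hΔ, scalarCurvature, Coord.scalar, Coord.laplacian, staticOp, ricciCurvature,
      Finset.mul_sum, ← Finset.sum_add_distrib, ← Finset.sum_sub_distrib]
    refine Finset.sum_congr rfl fun i _ => Finset.sum_congr rfl fun j _ => ?_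
    ring
  have h0 : ∑ i, ∑ j, (metricCoeff g e (e p))⁻¹ i j * staticOp g e u p i j = 0 := by
    simp [hu.interior_eq e he p hp]
  rw [h0, sum_inv_mul_self hpos, hR] at htr
  have hm' : (1 : ℝ) ≤ m := by exact_mod_cast hm
  have : (m : ℝ) * Δ = 0 := by
    push_cast at htr
    linarith
  exact (mul_eq_zero.mp this).resolve_left (by positivity)

/-- The trace of the boundary condition: `u_ν = 0` where `H = 0`. -/
lemma IsStaticPotential.normalDeriv_eq_zero (hm : 1 ≤ m) (hu : IsStaticPotential g Ω u)
    (hΩ : IsOpen Ω) (he : IsBoundaryChart Ω e) (hp : p ∈ e.source ∩ frontier Ω)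
    (hH : meanCurvature g e p = 0) : normalDeriv g e u p = 0 := by
  have hpos := posDef_inducedCoeff g he.1 hp.1 (he.coord_eq_zero hΩ hp.1 hp.2)
  have htr : normalDeriv g e u p * ∑ i, ∑ j, (inducedCoeff g e (boundaryCoord e p))⁻¹ i j *
      inducedCoeff g e (boundaryCoord e p) i j = u p * meanCurvature g e p := by
    simp only [meanCurvature, Finset.mul_sum]
    refine Finset.sum_congr rfl fun i _ => Finset.sum_congr rfl fun j _ => ?_
    have := hu.boundary_eq e he p hp i j
    linear_combination (inducedCoeff g e (boundaryCoord e p))⁻¹ i j * this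
  rw [sum_inv_mul_self hpos, hH, mul_zero] at htr
  have hm' : (m : ℝ) ≠ 0 := by
    have : (1 : ℝ) ≤ m := by exact_mod_cast hm
    positivity
  exact (mul_eq_zero.mp htr).resolve_right hm'

lemma IsStaticPotential.contDiffAt_comp_symm (hu : IsStaticPotential g Ω u) (hΩ : IsOpen Ω)
    (he : IsSmoothChart e) (hx : x ∈ e.target) (hxΩ : e.symm x ∈ Ω) :
    ContDiffAt ℝ 2 (u ∘ e.symm) x := by
  have h1 : ContMDiffAt 𝓘(ℝ, EuclideanSpace ℝ (Fin (m + 1))) 𝓘(ℝ, ℝ) ∞ u (e.symm x) :=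
    hu.smooth.contMDiffAt (mem_of_superset (hΩ.mem_nhds hxΩ) subset_closure)
  have h2 := h1.comp x (contMDiffAt_symm_of_mem_maximalAtlas he hx)
  exact h2.contDiffAt.of_le (by norm_cast)

lemma IsStaticPotential.contDiffWithinAt_comp_symm (hu : IsStaticPotential g Ω u)
    (he : IsBoundaryChart Ω e) (hx : x ∈ e.target) (h0 : 0 ≤ x 0) :
    ContDiffWithinAt ℝ ∞ (u ∘ e.symm) {x | 0 ≤ x 0} x := by
  have h1 := hu.smooth (e.symm x) (he.symm_mem_closure hx h0)
  have h2 := (contMDiffAt_symm_of_mem_maximalAtlas he.1 hx).contMDiffWithinAt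
    (s := {x : EuclideanSpace ℝ (Fin (m + 1)) | 0 ≤ x 0} ∩ e.target)
  have h3 := (h1.comp x h2 fun y hy => he.symm_mem_closure hy.2 hy.1).contDiffWithinAt
  exact (contDiffWithinAt_inter (e.open_target.mem_nhds hx)).mp h3

/-- The strong maximum principle: a static potential that attains its maximum inside `Ω` is constant. -/
lemma IsStaticPotential.eq_of_isMaxOn (hm : 1 ≤ m) (hu : IsStaticPotential g Ω u)
    (hΩ : IsSmoothDomain m Ω)
    (hR : ∀ e : OpenPartialHomeomorph M (EuclideanSpace ℝ (Fin (m + 1))),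
      IsSmoothChart e → ∀ p ∈ e.source ∩ Ω, scalarCurvature g e p = 0)
    (hp : p ∈ Ω) (hmax : IsMaxOn u Ω p) : ∀ q ∈ Ω, u q = u p := by
  have hcont : ContinuousOn u Ω := hu.smooth.continuousOn.mono subset_closure
  have hopen : IsOpen (Ω ∩ {q | u q = u p}) := by
    rw [isOpen_iff_mem_nhds]
    rintro q ⟨hq, hqp⟩
    set e := chartAt (EuclideanSpace ℝ (Fin (m + 1))) q with he
    have hec : IsSmoothChart e := IsManifold.chart_mem_maximalAtlas q
    have hqs : q ∈ e.source := mem_chart_source _ q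
    have hnear : ∀ᶠ y in 𝓝 (e q), y ∈ e.target ∧ e.symm y ∈ Ω :=
      Filter.Eventually.and (e.open_target.mem_nhds (e.map_source hqs))
        ((e.continuousAt_symm (e.map_source hqs)).eventually
          (by rw [e.left_inv hqs]; exact hΩ.isOpen.mem_nhds hq))
    have hloc := Coord.eventually_eq_of_harmonic_of_isLocalMax (G := metricCoeff g e)
      (v := u ∘ e.symm) (c := e q)
      (by
        filter_upwards [hnear] with y hy
        refine ⟨isMetricNear_metricCoeff g hec hy.1,
          hu.contDiffAt_comp_symm hΩ.isOpen hec hy.1 hy.2, ?_⟩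
        have hys : e.symm y ∈ e.source ∩ Ω := ⟨e.map_target hy.1, hy.2⟩
        have := hu.laplacian_eq_zero hm hec hys (hR e hec _ hys)
        rwa [e.right_inv hy.1] at this)
      (by
        filter_upwards [hnear] with y hy
        simp only [Function.comp_apply, e.left_inv hqs]
        exact (hmax hy.2).trans_eq hqp.symm)
    filter_upwards [(e.continuousAt hqs).eventually hloc, e.open_source.mem_nhds hqs,
      hΩ.isOpen.mem_nhds hq] with y hy hys hyΩ
    simp only [Function.comp_apply, e.left_inv hys, e.left_inv hqs] at hy
    exact ⟨hyΩ, hy.trans hqp⟩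
  have hopen' : IsOpen (Ω ∩ {q | u q ≠ u p}) :=
    hcont.isOpen_inter_preimage hΩ.isOpen isOpen_ne
  intro q hq
  by_contra hne
  obtain ⟨y, -, hy1, hy2⟩ := hΩ.isConnected.isPreconnected _ _ hopen hopen'
    (fun y hy => by
      by_cases h : u y = u p
      exacts [Or.inl ⟨hy, h⟩, Or.inr ⟨hy, h⟩])
    ⟨p, hp, hp, rfl⟩ ⟨q, hq, hq, hne⟩
  exact hy2.2 hy1.2

/-- By the Hopf lemma, a static potential with `u_ν = 0` at a boundary point that maximizes `u` over
`closure Ω` attains its maximum inside `Ω` too. -/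
lemma IsStaticPotential.exists_mem_eq_of_isMaxOn (hm : 1 ≤ m) (hu : IsStaticPotential g Ω u)
    (hΩ : IsSmoothDomain m Ω)
    (hR : ∀ e : OpenPartialHomeomorph M (EuclideanSpace ℝ (Fin (m + 1))),
      IsSmoothChart e → ∀ p ∈ e.source ∩ Ω, scalarCurvature g e p = 0)
    (he : IsBoundaryChart Ω e) (hp : p ∈ e.source ∩ frontier Ω)
    (hν : normalDeriv g e u p = 0) (hmax : IsMaxOn u (closure Ω) p) : ∃ q ∈ Ω, u q = u p := by
  by_contra! hne
  set v := u ∘ e.symm with hv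
  set φ : EuclideanSpace ℝ (Fin (m + 1)) →L[ℝ] ℝ := EuclideanSpace.proj 0 with hφ
  have hz := e.map_source hp.1
  have h0 := he.coord_eq_zero hΩ.isOpen hp.1 hp.2
  have hvz : v (e p) = u p := by simp [hv, e.left_inv hp.1]
  have hG := isMetricNear_metricCoeff g he.1 hz
  have hg00 : 0 < (metricCoeff g e (e p))⁻¹ 0 0 := hG.self_of_nhds.2.inv.diag_pos
  have hder := ((hu.contDiffWithinAt_comp_symm he hz h0.ge).differentiableWithinAt
    (by simp)).hasFDerivWithinAt
  have hb : 0 < fderiv ℝ φ (e p) (-(WithLp.toLp 2 (normal g e p))) := by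
    rw [φ.fderiv]
    change 0 < -normal g e p 0
    rw [normal, neg_div, neg_neg]
    positivity
  have hlt := Coord.hasFDerivWithinAt_neg_of_harmonic (φ := φ) (v := v) hG.self_of_nhds.1
    (hG.mono fun x hx => hx.2) φ.contDiff h0 (e.open_target.mem_nhds hz)
    (fun x hx hx0 => hu.contDiffAt_comp_symm hΩ.isOpen he.1 hx ((he.symm_mem_iff hx).mpr hx0))
    (fun x hx => (hu.contDiffWithinAt_comp_symm he hx.1 hx.2).continuousWithinAt.mono
      inter_subset_right)
    (fun x hx hx0 => by
      have hxs : e.symm x ∈ e.source ∩ Ω := ⟨e.map_target hx, (he.symm_mem_iff hx).mpr hx0⟩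
      have := hu.laplacian_eq_zero hm he.1 hxs (hR e he.1 _ hxs)
      rwa [e.right_inv hx] at this)
    (fun x hx hx0 => by
      have hxΩ := (he.symm_mem_iff hx).mpr hx0
      rw [hvz]
      exact lt_of_le_of_ne (hmax (subset_closure hxΩ)) (hne _ hxΩ))
    (fun x hx hx0 => by
      rw [hvz]
      exact hmax (he.symm_mem_closure hx hx0.ge))
    hder hb
  rw [map_neg] at hlt
  change -normalDeriv g e u p < 0 at hlt
  rw [hν] at hlt
  simp at hlt

/-- A harmonic function with vanishing normal derivative on a compact domain is constant. -/
theorem IsStaticPotential.exists_eq_const (hm : 1 ≤ m) (hu : IsStaticPotential g Ω u)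
    (hΩ : IsSmoothDomain m Ω) (hcomp : IsCompact (closure Ω))
    (hR : ∀ e : OpenPartialHomeomorph M (EuclideanSpace ℝ (Fin (m + 1))),
      IsSmoothChart e → ∀ p ∈ e.source ∩ Ω, scalarCurvature g e p = 0)
    (hH : ∀ e : OpenPartialHomeomorph M (EuclideanSpace ℝ (Fin (m + 1))),
      IsBoundaryChart Ω e → ∀ p ∈ e.source ∩ frontier Ω, meanCurvature g e p = 0) :
    ∃ c : ℝ, ∀ p ∈ closure Ω, u p = c := by
  obtain ⟨p, hp, hmax⟩ := hcomp.exists_isMaxOn hΩ.isConnected.nonempty.closure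
    hu.smooth.continuousOn
  obtain ⟨q, hq, hqp⟩ : ∃ q ∈ Ω, u q = u p := by
    by_cases hpΩ : p ∈ Ω
    · exact ⟨p, hpΩ, rfl⟩
    have hpf : p ∈ frontier Ω := by rw [hΩ.isOpen.frontier_eq]; exact ⟨hp, hpΩ⟩
    obtain ⟨e, he, hpe⟩ := hΩ.exists_boundaryChart p hpf
    exact hu.exists_mem_eq_of_isMaxOn hm hΩ hR he ⟨hpe, hpf⟩
      (hu.normalDeriv_eq_zero hm hΩ.isOpen he ⟨hpe, hpf⟩ (hH e he p ⟨hpe, hpf⟩)) hmax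
  have hconst := hu.eq_of_isMaxOn hm hΩ hR hq fun y hy =>
    (hmax (subset_closure hy)).trans_eq hqp.symm
  refine ⟨u p, fun y hy => ?_⟩
  have hcl : IsClosed ((closure Ω) ∩ u ⁻¹' {u p}) :=
    hu.smooth.continuousOn.preimage_isClosed_of_isClosed isClosed_closure isClosed_singleton
  have hsub : Ω ⊆ closure Ω ∩ u ⁻¹' {u p} := fun y hy =>
    ⟨subset_closure hy, (hconst y hy).trans hqp⟩
  exact (closure_minimal hsub hcl hy).2

/-- If a static potential is constant, then `Ω` is Ricci flat up to the boundary. -/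
lemma IsStaticPotential.ricci_eq_zero_of_const (hu : IsStaticPotential g Ω u) (hΩ : IsOpen Ω)
    {c : ℝ} (hc : ∀ p ∈ closure Ω, u p = c) (hc0 : c ≠ 0) (he : IsBoundaryChart Ω e)
    (hx : x ∈ e.target) (h0 : 0 ≤ x 0) (i j : Fin (m + 1)) :
    Coord.ricci (metricCoeff g e) i j x = 0 := by
  have hin : ∀ y ∈ e.target, 0 < y 0 → Coord.ricci (metricCoeff g e) i j y = 0 := by
    intro y hy hy0
    have hyΩ := (he.symm_mem_iff hy).mpr hy0
    have hconst : ∀ᶠ y' in 𝓝 y, (u ∘ e.symm) y' = c := by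
      filter_upwards [(e.continuousAt_symm hy).eventually (hΩ.mem_nhds hyΩ)] with y' hy'
        using hc _ (subset_closure hy')
    have hstat := hu.interior_eq e he.1 (e.symm y) ⟨e.map_target hy, hyΩ⟩ i j
    simp only [staticOp, ricciCurvature, e.right_inv hy, Coord.laplacian,
      Coord.hess_eq_zero_of_eventually_const hconst, hc _ (subset_closure hyΩ)] at hstat
    simpa [hc0] using hstat
  -- The metric is smooth across the boundary, so the Ricci curvature is continuous up to it.
  have hmet := (isMetricNear_metricCoeff g he.1 hx).self_of_nhds
  have hcont := (Coord.contDiffAt_ricci hmet.1 hmet.2.det_pos.ne' i j).continuousAt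
  have hlim := hcont.tendsto.comp (tendsto_add_single x)
  refine tendsto_nhds_unique hlim (tendsto_const_nhds.congr' ?_)
  filter_upwards [(tendsto_add_single x).eventually (e.open_target.mem_nhds hx),
    self_mem_nhdsWithin] with t ht ht0
  have ht0' : 0 < t := ht0
  refine (hin _ ht ?_).symm
  simp
  linarith

/-- In a boundary chart, `ν` is `-1 / √g^00` times the metric dual of `dx_0`; hence
`h_ij = Γ^0_ij / √g^00`. -/
lemma secondFF_eq (g : SmoothMetric m M) (he : IsSmoothChart e) (hp : p ∈ e.source) (i j : Fin m) :
    secondFF g e p i j = Coord.christoffel (metricCoeff g e) 0 i.succ j.succ (e p) /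
      √((metricCoeff g e (e p))⁻¹ 0 0) := by
  have hpos := posDef_metricCoeff g he (e.map_source hp)
  set A := metricCoeff g e (e p) with hA
  have hdual : ∀ l, ∑ k, A k l * A⁻¹ k 0 = if l = 0 then 1 else 0 := fun l => by
    have h := congrFun (congrFun
      (Matrix.mul_nonsing_inv A (isUnit_iff_ne_zero.mpr hpos.det_pos.ne')) l) 0
    rw [Matrix.mul_apply, Matrix.one_apply] at h
    rw [← h]
    refine Finset.sum_congr rfl fun k _ => ?_
    rw [show A k l = A l k by simpa using hpos.1.apply l k]
  have hterm : ∀ k l, A k l * normal g e p k *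
      Coord.christoffel (metricCoeff g e) l i.succ j.succ (e p) =
      -(Coord.christoffel (metricCoeff g e) l i.succ j.succ (e p) / √(A⁻¹ 0 0) *
        (A k l * A⁻¹ k 0)) := fun k l => by
    simp only [normal, ← hA]
    ring
  simp only [secondFF, ← hA, hterm]
  rw [Finset.sum_comm]
  simp [Finset.sum_neg_distrib, ← Finset.mul_sum, hdual]

/-- If a static potential is constant and `u_ν = 0`, then the boundary is totally geodesic. -/
lemma IsStaticPotential.christoffel_eq_zero_of_const (hu : IsStaticPotential g Ω u) {c : ℝ}
    (hc : ∀ p ∈ closure Ω, u p = c) (hc0 : c ≠ 0) (he : IsBoundaryChart Ω e)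
    (hp : p ∈ e.source ∩ frontier Ω) (hν : normalDeriv g e u p = 0) (i j : Fin m) :
    Coord.christoffel (metricCoeff g e) 0 i.succ j.succ (e p) = 0 := by
  have hb := hu.boundary_eq e he p hp i j
  rw [hν, zero_mul, hc p (frontier_subset_closure hp.2), secondFF_eq g he.1 hp.1] at hb
  have hg00 : 0 < (metricCoeff g e (e p))⁻¹ 0 0 :=
    (posDef_metricCoeff g he.1 (e.map_source hp.1)).inv.diag_pos
  have hs : √((metricCoeff g e (e p))⁻¹ 0 0) ≠ 0 := (Real.sqrt_pos.mpr hg00).ne'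
  have := (mul_eq_zero.mp hb.symm).resolve_left hc0
  exact (div_eq_zero_iff.mp this).resolve_right hs

end Potential

end StaticBoundary

end

/-! ### Scalar-flat domains with minimal boundary -/

theorem mainTheorem8 (m : ℕ) (hm : 1 ≤ m) (M : Type*) [TopologicalSpace M] [T2Space M]
    [ChartedSpace (EuclideanSpace ℝ (Fin (m + 1))) M]
    [IsManifold 𝓘(ℝ, EuclideanSpace ℝ (Fin (m + 1))) ∞ M]
    (g : StaticBoundary.SmoothMetric m M) (Ω : Set M)
    (hΩ : StaticBoundary.IsCompactNonGenericDomain g Ω)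
    -- the scalar curvature `R` vanishes in `Ω`
    (hR : ∀ e : OpenPartialHomeomorph M (EuclideanSpace ℝ (Fin (m + 1))),
      StaticBoundary.IsSmoothChart e → ∀ p ∈ e.source ∩ Ω,
        StaticBoundary.scalarCurvature g e p = 0)
    -- the mean curvature `H` vanishes on the boundary
    (hH : ∀ e : OpenPartialHomeomorph M (EuclideanSpace ℝ (Fin (m + 1))),
      StaticBoundary.IsBoundaryChart Ω e → ∀ p ∈ e.source ∩ frontier Ω,
        StaticBoundary.meanCurvature g e p = 0) :
    (∀ u : M → ℝ, StaticBoundary.IsStaticPotential g Ω u → ∃ c : ℝ, ∀ p ∈ closure Ω, u p = c) ∧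
    ∀ e : OpenPartialHomeomorph M (EuclideanSpace ℝ (Fin (m + 1))),
      StaticBoundary.IsBoundaryChart Ω e → ∀ p ∈ e.source ∩ frontier Ω,
        StaticBoundary.ricciNormal g e p = 0 ∧ StaticBoundary.boundaryScalarCurvature g e p = 0 := by
  obtain ⟨hdom, hcomp, u, hu⟩ := hΩ
  refine ⟨fun u hu => hu.exists_eq_const hm hdom hcomp hR hH, fun e he p hp => ?_⟩
  obtain ⟨c, hc⟩ := hu.exists_eq_const hm hdom hcomp hR hH
  have hc0 : c ≠ 0 := by
    obtain ⟨q, hq, hne⟩ := hu.nontrivial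
    rwa [hc q hq] at hne
  have hz := e.map_source hp.1
  have h0 := he.coord_eq_zero hdom.isOpen hp.1 hp.2
  have hric := hu.ricci_eq_zero_of_const hdom.isOpen hc hc0 he hz h0.ge
  refine ⟨by simp [StaticBoundary.ricciNormal, StaticBoundary.ricciCurvature, hric], ?_⟩
  have hy := StaticBoundary.hyperplaneIncl_boundaryCoord h0
  rw [StaticBoundary.boundaryScalarCurvature, StaticBoundary.inducedCoeff_eq]
  refine Coord.scalar_induced_eq_zero (by
      rw [hy]
      exact StaticBoundary.isMetricNear_metricCoeff g he.1 hz) ?_ (by rwa [hy])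
  have hnear : ∀ᶠ y in nhds (StaticBoundary.boundaryCoord e p),
      Coord.hyperplaneIncl m y ∈ e.target :=
    (Coord.hyperplaneIncl m).continuous.continuousAt.eventually
      (by rw [hy]; exact e.open_target.mem_nhds hz)
  filter_upwards [hnear] with y hyt i j
  have hq : e.symm (Coord.hyperplaneIncl m y) ∈ e.source ∩ frontier Ω :=
    ⟨e.map_target hyt, he.symm_mem_frontier hdom.isOpen hyt rfl⟩
  have := hu.christoffel_eq_zero_of_const hc hc0 he hq
    (hu.normalDeriv_eq_zero hm hdom.isOpen he hq (hH e he _ hq)) i j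
  rwa [e.right_inv hyt] at this
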